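/- **Setting.** Let $G$ be a (discrete) group and $\Gamma\le G$ an almost normal subgroup: for every $\sigma\in G$ the subgroup $\Gamma_\sigma=\sigma\Gamma\sigma^{-1}\cap\Gamma$ has finite index in $\Gamma$. Let $\mathcal S$ be the lattice of subgroups generated by all $\Gamma_\sigma$. Below, "coset" means a left or right coset $C\subseteq G$ of a subgroup in $\mathcal S$. Let $X_\Gamma$ be the (unital) algebra of functions on $G$ generated by the characteristic functions $\chi_C$ of cosets. The *localized free coset algebra* $\mathcal B(\Gamma,G)$ is the unital complex $*$-algebra generated by symbols $[C]$, one for each coset $C$, and by the algebra $X_\Gamma$ (as a unital subalgebra), with $[C]^*=[C^{-1}]$ (so $[\Gamma\sigma]^*=[\sigma^{-1}\Gamma]$) and $f^*=\bar f$ for $f\in X_\Gamma$, subject to the following relations (all families are finite): * $[\Gamma]=1$; * (0) $[C]=\sum_j[D_j]$ if the coset $C$ is the disjoint union of the cosets $D_j$; * (1) $[C_1]\chi_{C_2}=\sum_i\chi_{D_i}[A_i]$ if $C_1,C_2$ are cosets, $C_1$ is the disjoint union of the cosets $A_i$, and $cC_2=D_i$ for all $c\in A_i$, where $\chi_{D_i}\in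 X_\Gamma$; * (2) $\sum_i[\sigma_1^i\Gamma][\Gamma\sigma_2^i]=\sum_j[C_j]$ if the sets $\sigma_1^i\Gamma\sigma_2^i$ are pairwise disjoint, the cosets $C_j$ are pairwise disjoint, and both families have the same union; * (3) $\chi_\Gamma[\sigma_1\Gamma][\sigma_2\Gamma]^*\chi_\Gamma=\delta_{\sigma_1\Gamma,\sigma_2\Gamma}\,\chi_\Gamma$ for $\sigma_1,\sigma_2\in G$; * (4) $\sum_i[\Gamma\sigma s_i]\chi_\Gamma[\Gamma\sigma s_i]^*=\chi_{\Gamma\sigma\Gamma}$ and (5) $\sum_i[\Gamma\sigma s_i][\Gamma\sigma s_i]^*=[\Gamma:\Gamma_\sigma]\cdot 1$ if $\Gamma\sigma\Gamma$ is the disjoint union of the cosets $\Gamma\sigma s_i$. For a 2-cocycle $\varepsilon:G\times G\to\mathbb T$ let $\lambda_\varepsilon(g)\delta_h=\varepsilon(g,h)\delta_{gh}$ on $\ell^2(G)$, and let $\mathcal L(G)$ denote the von Neumann algebra on $\ell^2(G)$ generated by all $\lambda_\varepsilon(g)$ (the usual group von Neumann algebra if $\varepsilon=1$). For $x\in\mathcal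 L(G)$ write $x=\sum_{\theta}x_\theta\,\theta$, where $x_\theta=\langle x\delta_e,\lambda_\varepsilon(\theta)\delta_e\rangle$; $x$ is supported on $A\subseteq G$ if $x_\theta=0$ for $\theta\notin A$. **Theorem.** Suppose that $\pi$ is a unitary representation of $G$ on $\ell^2(\Gamma)$, or more generally a projective one with 2-cocycle $\varepsilon$, i.e. $\pi(g)\pi(h)=\varepsilon(g,h)\pi(gh)$, that extends the left regular representation of $\Gamma$ (with cocycle $\varepsilon|_{\Gamma\times\Gamma}$). Put $t(g)=\overline{\langle\pi(g)1,1\rangle}$, where $1=\delta_e\in\ell^2(\Gamma)$. Then there is a unital $*$-representation $\rho$ of $\mathcal B(\Gamma,G)$ by bounded operators on $\ell^2(G)$ such that: * for every coset $C$, $\rho([C])$ is an element of $\mathcal L(G)$, namely $t^C=\sum_{\theta\in C}t(\theta)\,\theta$; * for every $f\in X_\Gamma$, $\rho(f)$ is the operator of multiplication by $f$ on $\ell^2(G)$; * for all $\sigma_1,\sigma_2\in G$, $\rho([\sigma_1\Gamma][\Gamma\sigma_2])=\sum_{\theta\in\sigma_1\Gamma\sigma_2}t(\theta)\,\theta\in\mathcal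 L(G)$; in particular it is supported on $\sigma_1\Gamma\sigma_2$; * $\rho$ is faithful on the space of left cosets of $\Gamma$, on the space of right cosets of $\Gamma$ and on the Hecke algebra $\mathbb C(\Gamma\backslash G/\Gamma)$: each of the families $\rho([\sigma\Gamma])$ (indexed by left cosets), $\rho([\Gamma\sigma])$ (indexed by right cosets), and $\rho([\Gamma\sigma\Gamma])$ (indexed by double cosets), where $[\Gamma\sigma\Gamma]=\sum_i[s_i\Gamma]$ if $\Gamma\sigma\Gamma$ is the disjoint union of the $s_i\Gamma$, is linearly independent. -/

import Mathlib

open scoped Pointwise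

/-! ### The Hilbert spaces and (twisted) group von Neumann algebras -/

section GroupVonNeumann

variable {K : Type*} [Group K]

/-- `ℓ²(K)`. -/
abbrev EllTwo (K : Type*) : Type _ := lp (fun _ : K => ℂ) 2

open Classical in
/-- The basis vector `δ_k` of `ℓ²(K)`; for `k = 1` it is the vector called `1`. -/
noncomputable def basisVec (k : K) : EllTwo K := lp.single 2 k (1 : ℂ)

/-- `ε` is a 2-cocycle on `K` with values in the unit circle. -/
def IsTwoCocycle (ε : K → K → Circle) : Prop :=
  ∀ a b c : K, ε a b * ε (a * b) c = ε b c * ε a (b * c)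

theorem memlp_twistedLeft (ε : K → K → Circle) (k : K) (ξ : EllTwo K) :
    Memℓp (fun h : K => ((ε k (k⁻¹ * h) : Circle) : ℂ) * ξ (k⁻¹ * h)) 2 := by
  have h2 : (0 : ℝ) < (2 : ENNReal).toReal := by norm_num
  have hs := (memℓp_gen_iff h2).1 (lp.memℓp ξ)
  refine (memℓp_gen_iff h2).2 ?_
  have := (Equiv.mulLeft k⁻¹).summable_iff.2 hs
  refine this.congr fun h => ?_
  simp [Circle.norm_coe]

/-- The left regular representation of `K` on `ℓ²(K)` with cocycle `ε`:
`λ_ε(k) δ_h = ε(k,h) δ_{kh}`. For `ε = 1` this is the left regular representation. -/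
noncomputable def twistedLeft (ε : K → K → Circle) (k : K) : EllTwo K →L[ℂ] EllTwo K :=
  LinearMap.mkContinuous
    { toFun := fun ξ => ⟨fun h : K => ((ε k (k⁻¹ * h) : Circle) : ℂ) * ξ (k⁻¹ * h),
        memlp_twistedLeft ε k ξ⟩
      map_add' := fun ξ η => by ext h; exact mul_add _ _ _
      map_smul' := fun c ξ => by ext h; exact mul_left_comm _ _ _ }
    1 (fun ξ => by
      have h2 : (0 : ℝ) < (2 : ENNReal).toReal := by norm_num
      rw [one_mul, lp.norm_eq_tsum_rpow h2, lp.norm_eq_tsum_rpow h2]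
      refine le_of_eq (congrArg (fun x : ℝ => x ^ (1 / (2 : ENNReal).toReal)) ?_)
      rw [← (Equiv.mulLeft k⁻¹).tsum_eq (fun h : K => ‖ξ h‖ ^ (2 : ENNReal).toReal)]
      refine tsum_congr fun h => ?_
      simp [Circle.norm_coe])

/-- The von Neumann algebra `L(K)` of `K` (with cocycle `ε`) on `ℓ²(K)`: the von Neumann algebra
generated by the operators `λ_ε(k)`, i.e. the bicommutant of these operators and their adjoints.
For `ε = 1` this is the usual group von Neumann algebra. -/
noncomputable def groupVN (ε : K → K → Circle) : VonNeumannAlgebra (EllTwo K) where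
  toStarSubalgebra := StarSubalgebra.centralizer ℂ
    (StarSubalgebra.centralizer ℂ (Set.range (twistedLeft ε)) : Set (EllTwo K →L[ℂ] EllTwo K))
  centralizer_centralizer' :=
    Set.centralizer_centralizer_centralizer _

/-- The coefficient of `x ∈ L(K)` at `k`, i.e. `τ(λ_ε(k)* x) = ⟨x δ_1, λ_ε(k) δ_1⟩`: it is `x_k`
when `x = ∑ x_k λ_ε(k)`. (Mathlib's inner product is linear in the second variable.) -/
noncomputable def coeffVN (ε : K → K → Circle) (x : EllTwo K →L[ℂ] EllTwo K) (k : K) : ℂ :=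
  inner ℂ (twistedLeft ε k (basisVec 1)) (x (basisVec 1))

/-- `x` is the element `∑_{k ∈ A} t(k) k` of `L(K)` (with cocycle `ε`).
In particular `x` lies in `L(K)` and is supported on `A`. -/
def IsSeriesVN (ε : K → K → Circle) (t : K → ℂ) (A : Set K)
    (x : EllTwo K →L[ℂ] EllTwo K) : Prop :=
  x ∈ groupVN ε ∧ ∀ k, coeffVN ε x k = A.indicator t k

end GroupVonNeumann

section CosetAlgebra

variable {G : Type*} [Group G]

/-- `Γ_σ = σ Γ σ⁻¹ ∩ Γ`. -/
def conjInter (Γ : Subgroup G) (σ : G) : Subgroup G :=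
  Γ.map (MulAut.conj σ).toMonoidHom ⊓ Γ

/-- `Γ` is almost normal in `G`: every `Γ_σ` has finite index in `Γ`. -/
def IsAlmostNormal (Γ : Subgroup G) : Prop :=
  ∀ σ : G, (conjInter Γ σ).relIndex Γ ≠ 0

/-- The lattice `S` of subgroups generated by the `Γ_σ`. -/
def modularLattice (Γ : Subgroup G) : Set (Subgroup G) :=
  latticeClosure (Set.range (conjInter Γ))

theorem self_mem_modularLattice (Γ : Subgroup G) : Γ ∈ modularLattice Γ := by
  refine subset_latticeClosure ⟨1, ?_⟩
  simp only [conjInter, map_one]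
  refine inf_eq_right.2 fun x hx => ⟨x, hx, rfl⟩

/-- `C` is a left or a right coset of a subgroup in `S`. -/
def IsModularCoset (Γ : Subgroup G) (C : Set G) : Prop :=
  ∃ H ∈ modularLattice Γ, ∃ g : G,
    C = g • (H : Set G) ∨ C = MulOpposite.op g • (H : Set G)

theorem IsModularCoset.inv {Γ : Subgroup G} {C : Set G} (hC : IsModularCoset Γ C) :
    IsModularCoset Γ C⁻¹ := by
  obtain ⟨H, hH, g, h | h⟩ := hC
  · refine ⟨H, hH, g⁻¹, Or.inr ?_⟩
    subst h
    ext x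
    simp [Set.mem_smul_set_iff_inv_smul_mem]
  · refine ⟨H, hH, g⁻¹, Or.inl ?_⟩
    subst h
    ext x
    simp [Set.mem_smul_set_iff_inv_smul_mem]

/-- The cosets (left or right) of subgroups in `S`. -/
abbrev ModularCoset (Γ : Subgroup G) : Type _ := {C : Set G // IsModularCoset Γ C}

/-- The left coset `σΓ`. -/
def leftCos (Γ : Subgroup G) (σ : G) : ModularCoset Γ :=
  ⟨σ • (Γ : Set G), Γ, self_mem_modularLattice Γ, σ, Or.inl rfl⟩

/-- The right coset `Γσ`. -/
def rightCos (Γ : Subgroup G) (σ : G) : ModularCoset Γ :=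
  ⟨MulOpposite.op σ • (Γ : Set G), Γ, self_mem_modularLattice Γ, σ, Or.inr rfl⟩

/-- The set `σ₁ Γ σ₂`. -/
def biCos (Γ : Subgroup G) (σ₁ σ₂ : G) : Set G :=
  {x | ∃ γ ∈ Γ, x = σ₁ * γ * σ₂}

/-- The algebra `X_Γ` of functions on `G` generated by the characteristic functions of the
cosets of subgroups in `S`. -/
noncomputable def cosetFunctions (Γ : Subgroup G) : StarSubalgebra ℂ (G → ℂ) :=
  StarAlgebra.adjoin ℂ
    {f | ∃ C : Set G, IsModularCoset Γ C ∧ f = C.indicator (fun _ => (1 : ℂ))}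

/-- The generators of the localized free coset algebra: the cosets `[C]` of subgroups in `S` and
the elements of `X_Γ`. -/
inductive CosetGen (Γ : Subgroup G) : Type _
  | coset (C : ModularCoset Γ) : CosetGen Γ
  | fn (f : cosetFunctions Γ) : CosetGen Γ

/-- The involution on generators: `[C]* = [C⁻¹]` and `f* = f̄`. -/
noncomputable def CosetGen.adj {Γ : Subgroup G} : CosetGen Γ → CosetGen Γ
  | .coset C => .coset ⟨(C : Set G)⁻¹, C.2.inv⟩
  | .fn f => .fn (star f)

theorem CosetGen.adj_adj {Γ : Subgroup G} (x : CosetGen Γ) : x.adj.adj = x := by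
  cases x <;> simp [CosetGen.adj]

/-- The free complex algebra on the generators. -/
abbrev FreeCosetAlg (Γ : Subgroup G) : Type _ := FreeAlgebra ℂ (CosetGen Γ)

/-- The opposite of the free algebra, with the complex conjugate scalar multiplication. -/
def ConjOpp (Γ : Subgroup G) : Type _ := (FreeCosetAlg Γ)ᵐᵒᵖ

noncomputable instance (Γ : Subgroup G) : Ring (ConjOpp Γ) :=
  inferInstanceAs (Ring (FreeCosetAlg Γ)ᵐᵒᵖ)

noncomputable instance (Γ : Subgroup G) : Algebra ℂ (ConjOpp Γ) :=
  RingHom.toAlgebra' ((algebraMap ℂ (FreeCosetAlg Γ)ᵐᵒᵖ).comp (starRingEnd ℂ))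
    (fun c x => Algebra.commutes (A := (FreeCosetAlg Γ)ᵐᵒᵖ) (starRingEnd ℂ c) x)

/-- The conjugate-linear antihomomorphism of the free algebra that extends `CosetGen.adj`. -/
noncomputable def freeAdjHom (Γ : Subgroup G) : FreeCosetAlg Γ →+* (FreeCosetAlg Γ)ᵐᵒᵖ :=
  (FreeAlgebra.lift ℂ (A := ConjOpp Γ)
    (fun x : CosetGen Γ => MulOpposite.op (FreeAlgebra.ι ℂ x.adj))).toRingHom

/-- The `*`-operation of the free algebra. -/
noncomputable def freeAdj {Γ : Subgroup G} (a : FreeCosetAlg Γ) : FreeCosetAlg Γ :=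
  (freeAdjHom Γ a).unop

theorem freeAdj_ι {Γ : Subgroup G} (x : CosetGen Γ) :
    freeAdj (FreeAlgebra.ι ℂ x) = FreeAlgebra.ι ℂ x.adj :=
  congrArg MulOpposite.unop (FreeAlgebra.lift_ι_apply (A := ConjOpp Γ)
    (fun x : CosetGen Γ => MulOpposite.op (FreeAlgebra.ι ℂ x.adj)) x)

theorem freeAdj_algebraMap {Γ : Subgroup G} (c : ℂ) :
    freeAdj (algebraMap ℂ (FreeCosetAlg Γ) c) = algebraMap ℂ _ (starRingEnd ℂ c) :=
  congrArg MulOpposite.unop (AlgHom.commutes (FreeAlgebra.lift ℂ (A := ConjOpp Γ)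
    (fun x : CosetGen Γ => MulOpposite.op (FreeAlgebra.ι ℂ x.adj))) c)

theorem freeAdj_mul {Γ : Subgroup G} (a b : FreeCosetAlg Γ) :
    freeAdj (a * b) = freeAdj b * freeAdj a := by
  simp [freeAdj]

theorem freeAdj_add {Γ : Subgroup G} (a b : FreeCosetAlg Γ) :
    freeAdj (a + b) = freeAdj a + freeAdj b := by
  simp [freeAdj]

theorem freeAdj_freeAdj {Γ : Subgroup G} (a : FreeCosetAlg Γ) : freeAdj (freeAdj a) = a := by
  induction a using FreeAlgebra.induction with
  | grade0 c => simp [freeAdj_algebraMap]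
  | grade1 x => simp [freeAdj_ι, CosetGen.adj_adj]
  | mul a b ha hb => simp [freeAdj_mul, ha, hb]
  | add a b ha hb => simp [freeAdj_add, ha, hb]

/-- The generator `[C]` of the free algebra. -/
noncomputable def freeCoset {Γ : Subgroup G} (C : ModularCoset Γ) : FreeCosetAlg Γ :=
  FreeAlgebra.ι ℂ (CosetGen.coset C)

/-- The generator `f ∈ X_Γ` of the free algebra. -/
noncomputable def freeFn {Γ : Subgroup G} (f : cosetFunctions Γ) : FreeCosetAlg Γ :=
  FreeAlgebra.ι ℂ (CosetGen.fn f)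

/-- `f` is the characteristic function of `D`. -/
def IsChar {Γ : Subgroup G} (f : cosetFunctions Γ) (D : Set G) : Prop :=
  (f : G → ℂ) = D.indicator (fun _ => (1 : ℂ))

open Classical in
/-- The defining relations of the localized free coset algebra. -/
inductive CosetRel (Γ : Subgroup G) : FreeCosetAlg Γ → FreeCosetAlg Γ → Prop
  /- `X_Γ` sits in the algebra as an algebra -/
  | fn_add (f g : cosetFunctions Γ) : CosetRel Γ (freeFn (f + g)) (freeFn f + freeFn g)
  | fn_mul (f g : cosetFunctions Γ) : CosetRel Γ (freeFn (f * g)) (freeFn f * freeFn g)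
  | fn_const (c : ℂ) :
      CosetRel Γ (freeFn (algebraMap ℂ (cosetFunctions Γ) c)) (algebraMap ℂ _ c)
  /- `[Γ]` is the identity -/
  | unit : CosetRel Γ (freeCoset (leftCos Γ 1)) 1
  /- `[C] = ∑ [D_j]` for a partition of a coset `C` into cosets -/
  | partition {n : ℕ} (C : ModularCoset Γ) (D : Fin n → ModularCoset Γ)
      (hdisj : Pairwise fun i j => Disjoint (D i : Set G) (D j : Set G))
      (hunion : (C : Set G) = ⋃ i, (D i : Set G)) :
      CosetRel Γ (freeCoset C) (∑ i, freeCoset (D i))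
  /- `[C₁] χ_{C₂} = ∑ χ_{D_i} [A_i]`, if `C₁` is the disjoint union of cosets `A_i` and
  `c C₂ = D_i` for all `c ∈ A_i` -/
  | localize {n : ℕ} (C₁ C₂ : ModularCoset Γ) (A : Fin n → ModularCoset Γ) (D : Fin n → Set G)
      (f : cosetFunctions Γ) (d : Fin n → cosetFunctions Γ)
      (hdisj : Pairwise fun i j => Disjoint (A i : Set G) (A j : Set G))
      (hunion : (C₁ : Set G) = ⋃ i, (A i : Set G))
      (hD : ∀ i, ∀ c ∈ (A i : Set G), c • (C₂ : Set G) = D i)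
      (hf : IsChar f C₂) (hd : ∀ i, IsChar (d i) (D i)) :
      CosetRel Γ (freeCoset C₁ * freeFn f) (∑ i, freeFn (d i) * freeCoset (A i))
  /- `∑ [σ₁ⁱΓ][Γσ₂ⁱ] = ∑ [C_j]`, if the `σ₁ⁱΓσ₂ⁱ` are disjoint, the cosets `C_j` are disjoint and
  both families have the same union -/
  | concat {n m : ℕ} (σ₁ σ₂ : Fin n → G) (C : Fin m → ModularCoset Γ)
      (hdisj : Pairwise fun i j =>
        Disjoint (biCos Γ (σ₁ i) (σ₂ i)) (biCos Γ (σ₁ j) (σ₂ j)))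
      (hdisj' : Pairwise fun i j => Disjoint (C i : Set G) (C j : Set G))
      (hunion : ⋃ i, biCos Γ (σ₁ i) (σ₂ i) = ⋃ j, (C j : Set G)) :
      CosetRel Γ (∑ i, freeCoset (leftCos Γ (σ₁ i)) * freeCoset (rightCos Γ (σ₂ i)))
        (∑ j, freeCoset (C j))
  /- `χ_Γ [σ₁Γ][σ₂Γ]* χ_Γ = δ_{σ₁Γ, σ₂Γ} χ_Γ` -/
  | ortho (σ₁ σ₂ : G) (f : cosetFunctions Γ) (hf : IsChar f (Γ : Set G)) :
      CosetRel Γ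
        (freeFn f * freeCoset (leftCos Γ σ₁) * freeCoset (rightCos Γ σ₂⁻¹) * freeFn f)
        (if leftCos Γ σ₁ = leftCos Γ σ₂ then freeFn f else 0)
  /- `∑ [Γσs_i] χ_Γ [Γσs_i]* = χ_{ΓσΓ}`, if `ΓσΓ` is the disjoint union of the `Γσs_i` -/
  | basis {n : ℕ} (σ : G) (s : Fin n → G) (f d : cosetFunctions Γ)
      (hdisj : Pairwise fun i j =>
        Disjoint (rightCos Γ (σ * s i) : Set G) (rightCos Γ (σ * s j) : Set G))
      (hunion : DoubleCoset.doubleCoset σ (Γ : Set G) (Γ : Set G) =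
        ⋃ i, (rightCos Γ (σ * s i) : Set G))
      (hf : IsChar f (Γ : Set G))
      (hd : IsChar d (DoubleCoset.doubleCoset σ (Γ : Set G) (Γ : Set G))) :
      CosetRel Γ
        (∑ i, freeCoset (rightCos Γ (σ * s i)) * freeFn f * freeCoset (leftCos Γ (σ * s i)⁻¹))
        (freeFn d)
  /- `∑ [Γσs_i] [Γσs_i]* = [Γ : Γ_σ]`, if `ΓσΓ` is the disjoint union of the `Γσs_i` -/
  | index {n : ℕ} (σ : G) (s : Fin n → G)
      (hdisj : Pairwise fun i j =>
        Disjoint (rightCos Γ (σ * s i) : Set G) (rightCos Γ (σ * s j) : Set G))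
      (hunion : DoubleCoset.doubleCoset σ (Γ : Set G) (Γ : Set G) =
        ⋃ i, (rightCos Γ (σ * s i) : Set G)) :
      CosetRel Γ
        (∑ i, freeCoset (rightCos Γ (σ * s i)) * freeCoset (leftCos Γ (σ * s i)⁻¹))
        (algebraMap ℂ _ ((conjInter Γ σ).relIndex Γ : ℂ))
  /- the relations are closed under the `*`-operation -/
  | adj {a b : FreeCosetAlg Γ} (h : CosetRel Γ a b) : CosetRel Γ (freeAdj a) (freeAdj b)

/-- The localized free coset algebra `B(Γ, G)`. -/
def LocCosetAlg (Γ : Subgroup G) : Type _ := RingQuot (CosetRel Γ)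

noncomputable instance (Γ : Subgroup G) : Ring (LocCosetAlg Γ) :=
  inferInstanceAs (Ring (RingQuot (CosetRel Γ)))

noncomputable instance (Γ : Subgroup G) : Algebra ℂ (LocCosetAlg Γ) :=
  inferInstanceAs (Algebra ℂ (RingQuot (CosetRel Γ)))

/-- The quotient map from the free algebra. -/
noncomputable def LocCosetAlg.mk (Γ : Subgroup G) : FreeCosetAlg Γ →ₐ[ℂ] LocCosetAlg Γ :=
  RingQuot.mkAlgHom ℂ (CosetRel Γ)

theorem LocCosetAlg.mk_surjective (Γ : Subgroup G) :
    Function.Surjective (LocCosetAlg.mk Γ) :=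
  RingQuot.mkAlgHom_surjective ℂ (CosetRel Γ)

theorem LocCosetAlg.mk_rel {Γ : Subgroup G} {a b : FreeCosetAlg Γ} (h : CosetRel Γ a b) :
    LocCosetAlg.mk Γ a = LocCosetAlg.mk Γ b :=
  RingQuot.mkAlgHom_rel ℂ h

/-- The `*`-operation of `B(Γ, G)`, as a homomorphism into the opposite ring. -/
noncomputable def LocCosetAlg.adjHom (Γ : Subgroup G) :
    LocCosetAlg Γ →+* (LocCosetAlg Γ)ᵐᵒᵖ :=
  RingQuot.lift (r := CosetRel Γ) ⟨((LocCosetAlg.mk Γ).toRingHom.op).comp (freeAdjHom Γ),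
    fun _ _ h => congrArg MulOpposite.op (LocCosetAlg.mk_rel (CosetRel.adj h))⟩

theorem LocCosetAlg.adjHom_mk {Γ : Subgroup G} (a : FreeCosetAlg Γ) :
    LocCosetAlg.adjHom Γ (LocCosetAlg.mk Γ a) =
      MulOpposite.op (LocCosetAlg.mk Γ (freeAdj a)) := by
  have h : LocCosetAlg.mk Γ a = RingQuot.mkRingHom (CosetRel Γ) a :=
    DFunLike.congr_fun (RingQuot.mkAlgHom_coe ℂ (CosetRel Γ)) a
  rw [h]
  exact RingQuot.lift_mkRingHom_apply _ _ a

/-- `B(Γ, G)` is a `*`-algebra, with `[C]* = [C⁻¹]` and `f* = f̄`. -/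
noncomputable instance (Γ : Subgroup G) : StarRing (LocCosetAlg Γ) where
  star b := (LocCosetAlg.adjHom Γ b).unop
  star_involutive b := by
    obtain ⟨a, rfl⟩ := LocCosetAlg.mk_surjective Γ b
    simp [LocCosetAlg.adjHom_mk, freeAdj_freeAdj]
  star_mul a b := by simp
  star_add a b := by simp

theorem LocCosetAlg.star_mk {Γ : Subgroup G} (a : FreeCosetAlg Γ) :
    star (LocCosetAlg.mk Γ a) = LocCosetAlg.mk Γ (freeAdj a) :=
  congrArg MulOpposite.unop (LocCosetAlg.adjHom_mk a)

instance (Γ : Subgroup G) : StarModule ℂ (LocCosetAlg Γ) where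
  star_smul c b := by
    obtain ⟨a, rfl⟩ := LocCosetAlg.mk_surjective Γ b
    rw [← map_smul, LocCosetAlg.star_mk, LocCosetAlg.star_mk, ← map_smul, Algebra.smul_def,
      freeAdj_mul, freeAdj_algebraMap, Algebra.smul_def, Algebra.commutes]
    rfl

/-- The element `[C]` of `B(Γ, G)`. -/
noncomputable def cosetElt {Γ : Subgroup G} (C : ModularCoset Γ) : LocCosetAlg Γ :=
  LocCosetAlg.mk Γ (freeCoset C)

/-- The element `f ∈ X_Γ` of `B(Γ, G)`. -/
noncomputable def fnElt {Γ : Subgroup G} (f : cosetFunctions Γ) : LocCosetAlg Γ :=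
  LocCosetAlg.mk Γ (freeFn f)

/-- The set of double cosets `ΓσΓ`. -/
def DoubleCosets (Γ : Subgroup G) : Set (Set G) :=
  Set.range fun σ : G => DoubleCoset.doubleCoset σ (Γ : Set G) (Γ : Set G)

/-- The element `[D] = ∑ [s_iΓ]` of `B(Γ, G)`, for a double coset `D` that is the (finite) disjoint
union of the left cosets `s_iΓ`. -/
noncomputable def doubleCosetElt (Γ : Subgroup G) (D : Set G) : LocCosetAlg Γ :=
  ∑ᶠ C ∈ {C : ModularCoset Γ | C ∈ Set.range (leftCos Γ) ∧ (C : Set G) ⊆ D}, cosetElt C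

end CosetAlgebra

section Representations

variable {G : Type*} [Group G]

/-- `π` is a projective unitary representation of `G` on `H` with 2-cocycle `ε`
(a unitary representation if `ε = 1`). -/
def IsProjectiveRep {H : Type*} [NormedAddCommGroup H] [InnerProductSpace ℂ H] [CompleteSpace H]
    (ε : G → G → Circle) (π : G → unitary (H →L[ℂ] H)) : Prop :=
  IsTwoCocycle ε ∧
    ∀ g h : G, (π g : H →L[ℂ] H) * (π h : H →L[ℂ] H) =
      ((ε g h : Circle) : ℂ) • (π (g * h) : H →L[ℂ] H)

/-- `π`, on `ℓ²(Γ)`, extends the left regular representation of `Γ` with the restricted cocycle. -/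
def ExtendsLeftRegular (Γ : Subgroup G) (ε : G → G → Circle)
    (π : G → unitary (EllTwo Γ →L[ℂ] EllTwo Γ)) : Prop :=
  ∀ γ : Γ, (π (γ : G) : EllTwo Γ →L[ℂ] EllTwo Γ) = twistedLeft (fun a b : Γ => ε a b) γ

/-- The complex conjugate of the matrix coefficient `⟨π(g)1, 1⟩`, the scalar product being linear
in the first variable (Mathlib's is linear in the second one). -/
noncomputable def matCoeff {Γ : Subgroup G} (π : G → unitary (EllTwo Γ →L[ℂ] EllTwo Γ)) (g : G) :
    ℂ :=
  inner ℂ ((π g : EllTwo Γ →L[ℂ] EllTwo Γ) (basisVec 1)) (basisVec 1)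

end Representations

/-! Let $w(g)$ be the complex conjugate of $\pi(g)^*1$ (`orbitVec`). Two facts carry the proof.
First, $\langle w(g),w(h)\rangle = t(gh^{-1})\,\varepsilon(gh^{-1},h)$ (`inner_orbitVec`), which is
the $(g,h)$ matrix entry of the formal sum $\sum_\theta t(\theta)\lambda_\varepsilon(\theta)$. So
$t^C$ has to be the Gram matrix of $w$ cut down to the entries with $gh^{-1}\in C$
(`IsGramOperator`). Second, $\pi(\gamma x)^*1$ is a unit scalar times
$\pi(x)^*\delta_{\gamma^{-1}}$, so on every right coset $\Gamma x$ the vectors $w(k)$ form an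
orthonormal basis of $\ell^2(\Gamma)$ (`isCosetBasis_orbitVec`).

Every defining relation becomes an identity between matrix entries. Products are sums $\sum_k\langle
w(g),w(k)\rangle\langle w(k),w(h)\rangle$ over unions of right cosets of $\Gamma$, and Parseval
evaluates the sum over each coset to $\langle w(g),w(h)\rangle$; when $gh^{-1}\in\Gamma$ this is
$\delta_{g,h}$.

Boundedness is where almost normality enters: for a coset of $H\le\Gamma$ the cut-down Gram matrix
is block diagonal, and each block involves only vectors from boundedly many right cosets of
$\Gamma$, so Bessel's inequality bounds it uniformly (`IsCosetBasis.exists_isGramOperator`). Such an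
operator lies in $\mathcal L(G)$ because it commutes, term by term in the matrix product, with the
commutant of the $\lambda_\varepsilon(\theta)$. Linear independence holds because the supports are
disjoint and $t$ vanishes identically on no coset of $\Gamma$. -/

section MatrixEntries

/-! ### Bounded operators on $\ell^2(K)$ and their matrix entries. -/

variable {K : Type*}

theorem basisVec_apply_self (k : K) : (basisVec k : EllTwo K) k = 1 := by
  simp [basisVec]

theorem basisVec_apply_ne {k h : K} (hkh : h ≠ k) : (basisVec k : EllTwo K) h = 0 := by
  simp [basisVec, hkh]

theorem inner_basisVec_left (k : K) (ξ : EllTwo K) : inner ℂ (basisVec k) ξ = ξ k := by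
  classical
  unfold basisVec
  convert lp.inner_single_left (𝕜 := ℂ) k (1 : ℂ) ξ using 2
  simp

theorem inner_basisVec_right (k : K) (ξ : EllTwo K) :
    inner ℂ ξ (basisVec k) = star (ξ k) := by
  rw [← inner_conj_symm, inner_basisVec_left]; rfl

/-- The action of a bounded operator on `ℓ²(K)` through its matrix entries. -/
theorem hasSum_entry_mul (T : EllTwo K →L[ℂ] EllTwo K) (ξ : EllTwo K) (g : K) :
    HasSum (fun k => T (basisVec k) g * ξ k) (T ξ g) := by
  classical
  have h1 : HasSum (fun k => T (lp.single 2 k (ξ k))) (T ξ) :=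
    (lp.hasSum_single (by simp) ξ).mapL T
  have h2 := h1.mapL (innerSL ℂ (basisVec g : EllTwo K))
  simp only [innerSL_apply_apply, inner_basisVec_left] at h2
  refine h2.congr_fun ?_
  intro k
  have : (lp.single 2 k (ξ k) : EllTwo K) = ξ k • basisVec k := by
    unfold basisVec
    rw [← lp.single_smul]
    simp only [smul_eq_mul, mul_one]
  rw [this, map_smul, lp.coeFn_smul, Pi.smul_apply, smul_eq_mul, mul_comm]

theorem operator_ext_entries {S T : EllTwo K →L[ℂ] EllTwo K}
    (h : ∀ g k, S (basisVec k) g = T (basisVec k) g) : S = T := by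
  ext ξ g
  refine (hasSum_entry_mul S ξ g).unique ?_
  simpa only [h] using hasSum_entry_mul T ξ g

theorem hasSum_entry_comp (S T : EllTwo K →L[ℂ] EllTwo K) (g h : K) :
    HasSum (fun k => S (basisVec k) g * T (basisVec h) k) ((S * T) (basisVec h) g) :=
  hasSum_entry_mul S (T (basisVec h)) g

theorem entry_star (T : EllTwo K →L[ℂ] EllTwo K) (g h : K) :
    (star T) (basisVec h) g = star (T (basisVec g) h) := by
  rw [← inner_basisVec_left, ContinuousLinearMap.star_eq_adjoint,
    ContinuousLinearMap.adjoint_inner_right, inner_basisVec_right]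

theorem entry_sum {ι : Type*} (s : Finset ι) (T : ι → EllTwo K →L[ℂ] EllTwo K) (g h : K) :
    (∑ i ∈ s, T i) (basisVec h) g = ∑ i ∈ s, T i (basisVec h) g := by
  rw [_root_.sum_apply, lp.coeFn_sum, Finset.sum_apply]

/-- A bounded function acts on `ℓ²(K)` by multiplication. -/
theorem exists_mulOperator (f : K → ℂ) (hf : ∃ B : ℝ, ∀ k, ‖f k‖ ≤ B) :
    ∃ T : EllTwo K →L[ℂ] EllTwo K, ∀ ξ k, T ξ k = f k * ξ k := by
  obtain ⟨B, hB⟩ := hf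
  have h2 : (0 : ℝ) < (2 : ENNReal).toReal := by norm_num
  have hle : ∀ (ξ : EllTwo K) (k : K),
      ‖f k * ξ k‖ ^ (2 : ENNReal).toReal ≤
        |B| ^ (2 : ENNReal).toReal * ‖ξ k‖ ^ (2 : ENNReal).toReal := fun ξ k => by
    rw [← Real.mul_rpow (abs_nonneg _) (norm_nonneg _), norm_mul]
    gcongr
    exact (hB k).trans (le_abs_self B)
  have hsum : ∀ ξ : EllTwo K, Summable fun k => ‖ξ k‖ ^ (2 : ENNReal).toReal := fun ξ =>
    (memℓp_gen_iff h2).1 (lp.memℓp ξ)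
  have hmem : ∀ ξ : EllTwo K, Memℓp (fun k => f k * ξ k) 2 := fun ξ =>
    (memℓp_gen_iff h2).2 (((hsum ξ).mul_left _).of_nonneg_of_le
      (fun k => by positivity) (hle ξ))
  -- The norm bound is `|B|` because `B` may be negative when `K` is empty.
  refine ⟨LinearMap.mkContinuous
    { toFun := fun ξ => ⟨fun k => f k * ξ k, hmem ξ⟩
      map_add' := fun ξ η => by ext k; exact mul_add _ _ _
      map_smul' := fun c ξ => by ext k; exact mul_left_comm _ _ _ } |B| fun ξ => ?_,
    fun ξ k => rfl⟩
  refine lp.norm_le_of_tsum_le h2 (by positivity) ?_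
  rw [Real.mul_rpow (abs_nonneg _) (norm_nonneg _), lp.norm_rpow_eq_tsum h2, ← tsum_mul_left]
  exact ((memℓp_gen_iff h2).1 (hmem ξ)).tsum_le_tsum (hle ξ) ((hsum ξ).mul_left _)

end MatrixEntries

/-! ### Coset bases and boundedness of the cut-down Gram matrices. -/

section CosetBasis

open scoped Classical

variable {G : Type*} [Group G] {E : Type*} [NormedAddCommGroup E] [InnerProductSpace ℂ E]

/-- The vectors `w k`, for `k` in a fixed right coset of `Γ`, form an orthonormal basis of `E`. -/
structure IsCosetBasis (Γ : Subgroup G) (w : G → E) : Prop where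
  hasSum_inner (x : G) (a b : E) :
    HasSum (fun k => if k * x⁻¹ ∈ Γ then inner ℂ a (w k) * inner ℂ (w k) b else 0) (inner ℂ a b)
  inner_eq (g h : G) (hgh : g * h⁻¹ ∈ Γ) : inner ℂ (w g) (w h) = if g = h then (1 : ℂ) else 0

/-- `T` is the operator on `ℓ²(G)` with matrix entries `⟨w g, w h⟩` where `g h⁻¹ ∈ A`,
and zero elsewhere. -/
def IsGramOperator (w : G → E) (A : Set G) (T : EllTwo G →L[ℂ] EllTwo G) : Prop :=
  ∀ g h, T (basisVec h) g = if g * h⁻¹ ∈ A then inner ℂ (w g) (w h) else 0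

/-- Bessel's inequality inside one right coset of $\Gamma$: the real part of Parseval with both
vectors equal to `η`, truncated to finitely many nonnegative terms. -/
theorem IsCosetBasis.sum_norm_inner_le {Γ : Subgroup G} {w : G → E} (hw : IsCosetBasis Γ w)
    (x : G) (η : E) (s : Finset G) (hs : ∀ k ∈ s, k * x⁻¹ ∈ Γ) :
    ∑ k ∈ s, ‖inner ℂ (w k) η‖ ^ 2 ≤ ‖η‖ ^ 2 := by
  have h := Complex.hasSum_re (hw.hasSum_inner x η η)
  have hterm : ∀ k, (if k * x⁻¹ ∈ Γ then inner ℂ η (w k) * inner ℂ (w k) η else 0 : ℂ).re =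
      if k * x⁻¹ ∈ Γ then ‖inner ℂ (w k) η‖ ^ 2 else 0 := fun k => by
    split_ifs
    · rw [← inner_conj_symm, Complex.conj_mul', ← Complex.ofReal_pow, Complex.ofReal_re]
    · rfl
  simp only [hterm] at h
  have hle := sum_le_hasSum s (fun k _ => by split_ifs <;> positivity) h
  have hη : (inner ℂ η η : ℂ).re = ‖η‖ ^ 2 := inner_self_eq_norm_sq (𝕜 := ℂ) η
  rw [hη] at hle
  refine le_trans (le_of_eq (Finset.sum_congr rfl fun k hk => ?_)) hle
  rw [if_pos (hs k hk)]

/-- The fibres of `q` use separate coordinates of `m`, so their Bessel bounds add up to $N^2\|m\|^2$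
however many fibres there are. -/
theorem exists_analysisOperator {X I : Type*} (w : X → E) (q : X → I) (N : ℝ) (hN : 0 ≤ N)
    (h : ∀ i η (s : Finset X), (∀ k ∈ s, q k = i) →
      ∑ k ∈ s, ‖inner ℂ (w k) η‖ ^ 2 ≤ N ^ 2 * ‖η‖ ^ 2) :
    ∃ S : lp (fun _ : I => E) 2 →L[ℂ] EllTwo X, ∀ m k, S m k = inner ℂ (w k) (m (q k)) := by
  have h2 : (0 : ℝ) < (2 : ENNReal).toReal := by norm_num
  have hle : ∀ (m : lp (fun _ : I => E) 2) (s : Finset X),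
      ∑ k ∈ s, ‖(inner ℂ (w k) (m (q k)) : ℂ)‖ ^ (2 : ENNReal).toReal ≤
        (N * ‖m‖) ^ (2 : ENNReal).toReal := fun m s => by
    have hm := lp.sum_rpow_le_norm_rpow h2 m (s.image q)
    simp only [ENNReal.toReal_ofNat, Real.rpow_ofNat] at hm ⊢
    rw [← Finset.sum_fiberwise_of_maps_to (g := q) (t := s.image q)
      (fun k hk => Finset.mem_image_of_mem q hk), mul_pow]
    refine le_trans ?_ (mul_le_mul_of_nonneg_left hm (sq_nonneg N))
    rw [Finset.mul_sum]
    refine Finset.sum_le_sum fun i _ => ?_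
    refine le_trans (le_of_eq (Finset.sum_congr rfl fun k hk => ?_))
      (h i (m i) {k ∈ s | q k = i} fun k hk => (Finset.mem_filter.1 hk).2)
    rw [(Finset.mem_filter.1 hk).2]
  have hmem : ∀ m : lp (fun _ : I => E) 2, Memℓp (fun k => (inner ℂ (w k) (m (q k)) : ℂ)) 2 :=
    fun m => memℓp_gen' (hle m)
  refine ⟨LinearMap.mkContinuous
    { toFun := fun m => ⟨fun k => inner ℂ (w k) (m (q k)), hmem m⟩
      map_add' := fun m n => by ext k; exact inner_add_right _ _ _
      map_smul' := fun c m => by ext k; exact inner_smul_right _ _ _ } N fun m => ?_,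
    fun m k => rfl⟩
  exact lp.norm_le_of_forall_sum_le h2 (by positivity) (hle m)

/-- A Gram matrix that is block diagonal with respect to two labellings of `G`, each having
uniform Bessel bounds on its fibres, is a bounded operator. -/
theorem exists_blockGramOperator [CompleteSpace E] {X I : Type*} (w : X → E) (p q : X → I)
    (M N : ℝ) (hM : 0 ≤ M) (hN : 0 ≤ N)
    (hp : ∀ i η (s : Finset X), (∀ k ∈ s, p k = i) →
      ∑ k ∈ s, ‖inner ℂ (w k) η‖ ^ 2 ≤ M ^ 2 * ‖η‖ ^ 2)
    (hq : ∀ i η (s : Finset X), (∀ k ∈ s, q k = i) →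
      ∑ k ∈ s, ‖inner ℂ (w k) η‖ ^ 2 ≤ N ^ 2 * ‖η‖ ^ 2) :
    ∃ T : EllTwo X →L[ℂ] EllTwo X, ∀ g h,
      T (basisVec h) g = if p g = q h then inner ℂ (w g) (w h) else 0 := by
  obtain ⟨S, hS⟩ := exists_analysisOperator w p M hM hp
  obtain ⟨R, hR⟩ := exists_analysisOperator w q N hN hq
  -- The adjoint of `R` places the vector `w h` in slot `q h`; `S` then reads slot `p g` against `w
  -- g`, and finds a nonzero vector only if `p g = q h`.
  refine ⟨S ∘L ContinuousLinearMap.adjoint R, fun g h => ?_⟩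
  have hadj : ContinuousLinearMap.adjoint R (basisVec h) = lp.single 2 (q h) (w h) := by
    refine ext_inner_right ℂ fun m => ?_
    rw [ContinuousLinearMap.adjoint_inner_left, inner_basisVec_left, hR, lp.inner_single_left]
  rw [ContinuousLinearMap.comp_apply, hadj, hS]
  split_ifs with hpq
  · rw [hpq, lp.single_apply_self]
  · rw [lp.single_apply_ne _ _ _ hpq, inner_zero_right]

/-- $\tau\Gamma$ meets only finitely many right cosets of $\Gamma$, since $\Gamma\tau\gamma$ depends
only on the coset of $\gamma$ modulo $\tau^{-1}\Gamma\tau\cap\Gamma$. -/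
theorem IsAlmostNormal.exists_finset_cover {Γ : Subgroup G} (hΓ : IsAlmostNormal Γ) (τ : G) :
    ∃ F : Finset G, ∀ γ ∈ Γ, ∃ s ∈ F, τ * γ * s⁻¹ ∈ Γ := by
  have hfin : ((conjInter Γ τ⁻¹).subgroupOf Γ).FiniteIndex := ⟨hΓ τ⁻¹⟩
  let r : Γ ⧸ (conjInter Γ τ⁻¹).subgroupOf Γ → G := fun c => τ * ((c.out : Γ) : G)⁻¹
  have : Fintype (Γ ⧸ (conjInter Γ τ⁻¹).subgroupOf Γ) := Fintype.ofFinite _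
  refine ⟨Finset.univ.image r, fun γ hγ => ?_⟩
  -- The quotient consists of left cosets while right cosets are needed here, hence the inverse of
  -- `γ`, and the inverse of the representative in `r`.
  let c : Γ ⧸ (conjInter Γ τ⁻¹).subgroupOf Γ := QuotientGroup.mk (⟨γ, hγ⟩⁻¹ : Γ)
  refine ⟨r c, Finset.mem_image_of_mem r (Finset.mem_univ c), ?_⟩
  have hc : (c.out)⁻¹ * (⟨γ, hγ⟩⁻¹ : Γ) ∈ (conjInter Γ τ⁻¹).subgroupOf Γ :=
    QuotientGroup.eq.1 (QuotientGroup.out_eq' c)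
  obtain ⟨⟨δ, hδ, hδ'⟩, -⟩ := Subgroup.mem_subgroupOf.1 hc
  simp only [MulEquiv.toMonoidHom_eq_coe, MonoidHom.coe_coe, MulAut.conj_apply, inv_inv,
    Subgroup.coe_mul, Subgroup.coe_inv] at hδ'
  have : τ * γ * (r c)⁻¹ = δ⁻¹ := by
    have : γ * (c.out : G) = ((c.out : G)⁻¹ * γ⁻¹)⁻¹ := by group
    simp only [r, mul_inv_rev, inv_inv]
    rw [show τ * γ * ((c.out : G) * τ⁻¹) = τ * (γ * (c.out : G)) * τ⁻¹ by group, this, ← hδ']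
    group
  rw [this]
  exact Γ.inv_mem hδ

theorem le_of_mem_modularLattice {Γ H : Subgroup G} (hH : H ∈ modularLattice Γ) : H ≤ Γ := by
  have : modularLattice Γ ⊆ Set.Iic Γ :=
    latticeClosure_min (by rintro _ ⟨σ, rfl⟩; exact Set.mem_Iic.2 inf_le_right)
      ⟨fun _ ha _ hb => Set.mem_Iic.2 (sup_le ha hb),
        fun _ ha _ _ => Set.mem_Iic.2 (inf_le_left.trans ha)⟩
  exact this hH

/-- A fibre of $k\mapsto H\tau k$ lies in some $\tau^{-1}\Gamma\tau k_0$, which `F.card` right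
cosets of $\Gamma$ cover, with `F.card` independent of the fibre. Each of them contributes at most
$\|\eta\|^2$, so $N=\sqrt{|F|}$ works. -/
theorem IsCosetBasis.bessel_translate {Γ H : Subgroup G} {w : G → E} (hw : IsCosetBasis Γ w)
    (hΓ : IsAlmostNormal Γ) (hH : H ≤ Γ) (τ : G) :
    ∃ N : ℝ, 0 ≤ N ∧ ∀ (i : Set G) η (s : Finset G),
      (∀ k ∈ s, MulOpposite.op (τ * k) • (H : Set G) = i) →
      ∑ k ∈ s, ‖inner ℂ (w k) η‖ ^ 2 ≤ N ^ 2 * ‖η‖ ^ 2 := by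
  obtain ⟨F, hF⟩ := hΓ.exists_finset_cover τ⁻¹
  refine ⟨√(F.card : ℝ), Real.sqrt_nonneg _, fun i η s hs => ?_⟩
  rw [Real.sq_sqrt (Nat.cast_nonneg _)]
  rcases s.eq_empty_or_nonempty with rfl | ⟨k₀, hk₀⟩
  · simp; positivity
  have hcov : ∀ k ∈ s, ∃ c ∈ F, k * (c * (τ * k₀))⁻¹ ∈ Γ := fun k hk => by
    have hmem : τ * k ∈ MulOpposite.op (τ * k₀) • (H : Set G) := by
      rw [hs k₀ hk₀, ← hs k hk]
      exact ⟨1, H.one_mem, by simp⟩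
    obtain ⟨γ, hγ, hγk⟩ := hmem
    obtain ⟨c, hc, hcΓ⟩ := hF γ (hH hγ)
    refine ⟨c, hc, ?_⟩
    have : k = τ⁻¹ * (γ * (τ * k₀)) := by
      simp only [MulOpposite.smul_eq_mul_unop, MulOpposite.unop_op] at hγk
      rw [hγk]; group
    rw [this]
    convert hcΓ using 1
    group
  choose! c hc hcΓ using hcov
  rw [← Finset.sum_fiberwise_of_maps_to (g := c) (t := F) hc, ← nsmul_eq_mul]
  refine Finset.sum_le_card_nsmul _ _ _ fun d _ => ?_
  refine hw.sum_norm_inner_le (d * (τ * k₀)) η _ fun k hk => ?_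
  obtain ⟨hks, rfl⟩ := Finset.mem_filter.1 hk
  exact hcΓ k hks

theorem op_smul_eq_op_smul_iff (H : Subgroup G) (a b : G) :
    MulOpposite.op a • (H : Set G) = MulOpposite.op b • (H : Set G) ↔ a * b⁻¹ ∈ H := by
  rw [rightCoset_eq_iff, ← H.inv_mem_iff]
  simp

theorem mem_smul_subgroup_iff (H : Subgroup G) (a b : G) :
    a ∈ b • (H : Set G) ↔ b⁻¹ * a ∈ H := mem_leftCoset_iff b

theorem mem_op_smul_subgroup_iff (H : Subgroup G) (a b : G) :
    a ∈ MulOpposite.op b • (H : Set G) ↔ a * b⁻¹ ∈ H := mem_rightCoset_iff b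

/-- The operators attached to the cosets are bounded. -/
theorem IsCosetBasis.exists_isGramOperator [CompleteSpace E] {Γ : Subgroup G} {w : G → E}
    (hw : IsCosetBasis Γ w) (hΓ : IsAlmostNormal Γ) {C : Set G} (hC : IsModularCoset Γ C) :
    ∃ T, IsGramOperator w C T := by
  obtain ⟨H, hH, σ, rfl | rfl⟩ := hC
  -- $gh^{-1}\in\sigma H$ means $H\sigma^{-1}g=Hh$, so the matrix is block diagonal for these two
  -- labellings.
  · obtain ⟨M, hM, hp⟩ := hw.bessel_translate hΓ (le_of_mem_modularLattice hH) σ⁻¹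
    obtain ⟨N, hN, hq⟩ := hw.bessel_translate hΓ (le_of_mem_modularLattice hH) 1
    obtain ⟨T, hT⟩ := exists_blockGramOperator w _ _ M N hM hN hp hq
    refine ⟨T, fun g h => ?_⟩
    rw [hT, op_smul_eq_op_smul_iff, mem_smul_subgroup_iff, one_mul, mul_assoc]
  -- Here $gh^{-1}\in H\sigma$ means $Hg=H\sigma h$.
  · obtain ⟨M, hM, hp⟩ := hw.bessel_translate hΓ (le_of_mem_modularLattice hH) 1
    obtain ⟨N, hN, hq⟩ := hw.bessel_translate hΓ (le_of_mem_modularLattice hH) σ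
    obtain ⟨T, hT⟩ := exists_blockGramOperator w _ _ M N hM hN hp hq
    refine ⟨T, fun g h => ?_⟩
    rw [hT, op_smul_eq_op_smul_iff, mem_op_smul_subgroup_iff, one_mul, mul_inv_rev, mul_assoc]

end CosetBasis

/-! ### Multiplication operators. -/

section MultiplicationOperators

variable {K : Type*}

/-- `M` is the operator of multiplication by `f` on `ℓ²(K)`. -/
def IsMulOperator (f : K → ℂ) (M : EllTwo K →L[ℂ] EllTwo K) : Prop :=
  ∀ ξ k, M ξ k = f k * ξ k

theorem IsMulOperator.apply_basisVec {f : K → ℂ} {M : EllTwo K →L[ℂ] EllTwo K}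
    (hM : IsMulOperator f M) (k : K) : M (basisVec k) = f k • basisVec k := by
  ext h
  rw [hM, lp.coeFn_smul, Pi.smul_apply, smul_eq_mul]
  rcases eq_or_ne h k with rfl | hk
  · rfl
  · rw [basisVec_apply_ne hk, mul_zero, mul_zero]

theorem IsMulOperator.unique {f : K → ℂ} {M N : EllTwo K →L[ℂ] EllTwo K}
    (hM : IsMulOperator f M) (hN : IsMulOperator f N) : M = N := by
  ext ξ k
  rw [hM, hN]

theorem IsMulOperator.entry_mul_left {f : K → ℂ} {M : EllTwo K →L[ℂ] EllTwo K}
    (hM : IsMulOperator f M) (T : EllTwo K →L[ℂ] EllTwo K) (g h : K) :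
    (M * T) (basisVec h) g = f g * T (basisVec h) g := hM _ _

theorem IsMulOperator.entry_mul_right {f : K → ℂ} {M : EllTwo K →L[ℂ] EllTwo K}
    (hM : IsMulOperator f M) (T : EllTwo K →L[ℂ] EllTwo K) (g h : K) :
    (T * M) (basisVec h) g = T (basisVec h) g * f h := by
  rw [mul_apply_eq_comp, hM.apply_basisVec, map_smul, lp.coeFn_smul, Pi.smul_apply,
    smul_eq_mul, mul_comm]

theorem IsMulOperator.star {f : K → ℂ} {M : EllTwo K →L[ℂ] EllTwo K}
    (hM : IsMulOperator f M) : IsMulOperator (star f) (star M) := fun ξ k => by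
  rw [← inner_basisVec_left, ContinuousLinearMap.star_eq_adjoint,
    ContinuousLinearMap.adjoint_inner_right, hM.apply_basisVec, inner_smul_left,
    inner_basisVec_left]
  rfl

end MultiplicationOperators

/-! ### The defining relations, verified on matrix entries. -/

section GramRelations

open scoped Classical

variable {G : Type*} [Group G] {E : Type*} [NormedAddCommGroup E] [InnerProductSpace ℂ E]
  {Γ : Subgroup G} {w : G → E}

theorem IsGramOperator.unique {A : Set G} {S T : EllTwo G →L[ℂ] EllTwo G}
    (hS : IsGramOperator w A S) (hT : IsGramOperator w A T) : S = T :=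
  operator_ext_entries fun g h => by rw [hS, hT]

theorem IsGramOperator.star {A : Set G} {T : EllTwo G →L[ℂ] EllTwo G}
    (hT : IsGramOperator w A T) : IsGramOperator w A⁻¹ (star T) := fun g h => by
  rw [entry_star, hT, Set.mem_inv, mul_inv_rev, inv_inv]
  split_ifs
  · exact inner_conj_symm _ _
  · exact star_zero _

theorem IsGramOperator.sum {ι : Type*} [Fintype ι] {A : ι → Set G}
    {T : ι → EllTwo G →L[ℂ] EllTwo G} (hT : ∀ i, IsGramOperator w (A i) (T i))
    (hA : Pairwise fun i j => Disjoint (A i) (A j)) :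
    IsGramOperator w (⋃ i, A i) (∑ i, T i) := fun g h => by
  rw [entry_sum]
  simp only [hT _ g h]
  split_ifs with hgh
  · obtain ⟨i, hi⟩ := Set.mem_iUnion.1 hgh
    rw [Finset.sum_eq_single i _ (fun hi' => absurd (Finset.mem_univ i) hi'), if_pos hi]
    exact fun j _ hji => if_neg fun hj => (Set.disjoint_left.1 (hA hji) hj hi)
  · exact Finset.sum_eq_zero fun i _ => if_neg fun hi => hgh (Set.mem_iUnion.2 ⟨i, hi⟩)

theorem IsCosetBasis.isGramOperator_one (hw : IsCosetBasis Γ w) :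
    IsGramOperator w (Γ : Set G) (1 : EllTwo G →L[ℂ] EllTwo G) := fun g h => by
  rw [one_apply_eq_self]
  split_ifs with hgh
  · rw [hw.inner_eq g h hgh]
    split_ifs with heq
    · rw [heq, basisVec_apply_self]
    · exact basisVec_apply_ne heq
  · refine basisVec_apply_ne ?_
    rintro rfl
    exact hgh (by simp [Γ.one_mem])

theorem mem_biCos_iff (σ₁ σ₂ x : G) : x ∈ biCos Γ σ₁ σ₂ ↔ σ₁⁻¹ * x * σ₂⁻¹ ∈ Γ := by
  constructor
  · rintro ⟨γ, hγ, rfl⟩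
    simpa [mul_assoc] using hγ
  · exact fun h => ⟨_, h, by group⟩

/-- The second factor restricts the summation index to $k\in\Gamma\sigma_2h$. For such $k$, the
condition $gk^{-1}\in\sigma_1\Gamma$ is equivalent to $gh^{-1}\in\sigma_1\Gamma\sigma_2$ and no
longer involves $k$, so Parseval on $\Gamma\sigma_2h$ gives the entry. -/
theorem IsCosetBasis.isGramOperator_mul (hw : IsCosetBasis Γ w) {σ₁ σ₂ : G}
    {S T : EllTwo G →L[ℂ] EllTwo G} (hS : IsGramOperator w (σ₁ • (Γ : Set G)) S)
    (hT : IsGramOperator w (MulOpposite.op σ₂ • (Γ : Set G)) T) :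
    IsGramOperator w (biCos Γ σ₁ σ₂) (S * T) := fun g h => by
  have hsum := hasSum_entry_comp S T g h
  simp only [hS g, hT _ h] at hsum
  refine hsum.unique ?_
  have key : ∀ k, (if g * k⁻¹ ∈ σ₁ • (Γ : Set G) then inner ℂ (w g) (w k) else 0) *
      (if k * h⁻¹ ∈ MulOpposite.op σ₂ • (Γ : Set G) then inner ℂ (w k) (w h) else 0) =
      if g * h⁻¹ ∈ biCos Γ σ₁ σ₂ then
        (if k * (σ₂ * h)⁻¹ ∈ Γ then inner ℂ (w g) (w k) * inner ℂ (w k) (w h) else 0)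
      else (0 : ℂ) := fun k => by
    have e1 : g * k⁻¹ ∈ σ₁ • (Γ : Set G) ↔ σ₁⁻¹ * g * k⁻¹ ∈ Γ := by
      rw [mem_smul_subgroup_iff, mul_assoc]
    have e2 : k * h⁻¹ ∈ MulOpposite.op σ₂ • (Γ : Set G) ↔ k * (σ₂ * h)⁻¹ ∈ Γ := by
      rw [mem_op_smul_subgroup_iff, mul_inv_rev, mul_assoc]
    have e3 : g * h⁻¹ ∈ biCos Γ σ₁ σ₂ ↔ (σ₁⁻¹ * g * k⁻¹) * (k * (σ₂ * h)⁻¹) ∈ Γ := by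
      rw [mem_biCos_iff]
      refine iff_of_eq (congrArg (· ∈ Γ) ?_)
      group
    rw [e3]
    simp only [e1, e2]
    by_cases hk : k * (σ₂ * h)⁻¹ ∈ Γ
    · simp only [if_pos hk, Γ.mul_mem_cancel_right hk]
      split_ifs <;> simp
    · simp only [if_neg hk, mul_zero, ite_self]
  simp only [key]
  split_ifs
  · exact hw.hasSum_inner _ _ _
  · exact hasSum_zero

/-- The finitely many left cosets `r i σ Γ` that make up `ΓσΓ`. -/
theorem IsAlmostNormal.exists_leftCoset_decomposition (hΓ : IsAlmostNormal Γ) (σ : G) :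
    ∃ r : Fin ((conjInter Γ σ).relIndex Γ) → G, (∀ i, r i ∈ Γ) ∧
      ∀ x ∈ DoubleCoset.doubleCoset σ (Γ : Set G) (Γ : Set G),
        ∃! i, x ∈ (r i * σ) • (Γ : Set G) := by
  have hfin : ((conjInter Γ σ).subgroupOf Γ).FiniteIndex := ⟨hΓ σ⟩
  let e : Γ ⧸ (conjInter Γ σ).subgroupOf Γ ≃ Fin ((conjInter Γ σ).relIndex Γ) :=
    Finite.equivFinOfCardEq rfl
  -- $(b\sigma)^{-1}a\sigma\in\Gamma$ says that $b^{-1}a\in\sigma\Gamma\sigma^{-1}$; thus the left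
  -- cosets of $\Gamma$ in $\Gamma\sigma\Gamma$ correspond to $\Gamma/\Gamma_\sigma$.
  have hmem : ∀ (a b δ : Γ), (a : G) * σ * δ ∈ ((b : G) * σ) • (Γ : Set G) ↔
      (QuotientGroup.mk b : Γ ⧸ (conjInter Γ σ).subgroupOf Γ) = QuotientGroup.mk a :=
      fun a b δ => by
    rw [mem_smul_subgroup_iff, QuotientGroup.eq, Subgroup.mem_subgroupOf, ← mul_assoc,
      Γ.mul_mem_cancel_right δ.2]
    constructor
    · intro h
      refine ⟨⟨_, h, ?_⟩, (b⁻¹ * a).2⟩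
      simp only [MulEquiv.toMonoidHom_eq_coe, MonoidHom.coe_coe, MulAut.conj_apply,
        Subgroup.coe_mul, Subgroup.coe_inv]
      group
    · rintro ⟨⟨δ, hδ, hδ'⟩, -⟩
      simp only [MulEquiv.toMonoidHom_eq_coe, MonoidHom.coe_coe, MulAut.conj_apply,
        Subgroup.coe_mul, Subgroup.coe_inv] at hδ'
      have : ((b : G) * σ)⁻¹ * (a * σ) = δ := by
        rw [mul_inv_rev, show σ⁻¹ * (b : G)⁻¹ * (a * σ) = σ⁻¹ * ((b : G)⁻¹ * a) * σ by group,
          ← hδ']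
        group
      rwa [this]
  refine ⟨fun i => (((e.symm i).out : Γ) : G), fun i => ((e.symm i).out).2, fun x hx => ?_⟩
  obtain ⟨a, ha, δ, hδ, rfl⟩ := DoubleCoset.mem_doubleCoset.1 hx
  have hm := fun b => hmem ⟨a, ha⟩ b ⟨δ, hδ⟩
  refine ⟨e (QuotientGroup.mk ⟨a, ha⟩), (hm _).2 (by simp), fun j hj => ?_⟩
  have := (hm _).1 hj
  rw [QuotientGroup.out_eq'] at this
  rw [← this, Equiv.apply_symm_apply]

/-- The `i`-th term asks that both `x` and `y` lie in $\Gamma a_i$. By disjointness at most one `i`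
qualifies, and it exists exactly when `x` and `y` share a right coset inside `D`. -/
theorem sum_ite_rightCosets {ι : Type*} [Fintype ι] {a : ι → G} {D : Set G}
    (hdisj : Pairwise fun i j => Disjoint (MulOpposite.op (a i) • (Γ : Set G))
      (MulOpposite.op (a j) • (Γ : Set G)))
    (hunion : D = ⋃ i, MulOpposite.op (a i) • (Γ : Set G)) (x y : G) (u v : ℂ) :
    ∑ i, (if x ∈ MulOpposite.op (a i) • (Γ : Set G) then u else 0) *
      (if y⁻¹ ∈ (a i)⁻¹ • (Γ : Set G) then v else 0) =
      if x * y⁻¹ ∈ Γ ∧ x ∈ D then u * v else 0 := by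
  have hy : ∀ i, x ∈ MulOpposite.op (a i) • (Γ : Set G) →
      (y⁻¹ ∈ (a i)⁻¹ • (Γ : Set G) ↔ x * y⁻¹ ∈ Γ) := fun i hi => by
    rw [mem_op_smul_subgroup_iff] at hi
    rw [mem_smul_subgroup_iff, inv_inv, ← Γ.mul_mem_cancel_left hi]
    refine iff_of_eq (congrArg (· ∈ Γ) ?_)
    group
  by_cases hx : x ∈ D
  · obtain ⟨i, hi⟩ := Set.mem_iUnion.1 (hunion ▸ hx)
    rw [Finset.sum_eq_single i _ (fun hi' => absurd (Finset.mem_univ i) hi'), if_pos hi]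
    · simp only [hy i hi, hx, and_true]
      split_ifs <;> simp
    · intro j _ hji
      rw [if_neg fun hj => (Set.disjoint_left.1 (hdisj hji) hj hi), zero_mul]
  · rw [if_neg fun h => hx h.2]
    refine Finset.sum_eq_zero fun i _ => ?_
    rw [if_neg fun hi => hx (hunion ▸ Set.mem_iUnion.2 ⟨i, hi⟩), zero_mul]

section Relations

variable {ι : Type*} [Fintype ι]

/-- At an entry with $c=gh^{-1}\in A_i$ one has $g=ch$, so $h\in C_2$ if and only if $g\in
cC_2=D_i$. -/
theorem IsGramOperator.mul_isMulOperator {C₁ C₂ : Set G} {A D : ι → Set G}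
    {T M : EllTwo G →L[ℂ] EllTwo G} {S N : ι → EllTwo G →L[ℂ] EllTwo G}
    (hdisj : Pairwise fun i j => Disjoint (A i) (A j)) (hunion : C₁ = ⋃ i, A i)
    (hD : ∀ i, ∀ c ∈ A i, c • C₂ = D i)
    (hT : IsGramOperator w C₁ T) (hS : ∀ i, IsGramOperator w (A i) (S i))
    (hM : IsMulOperator (C₂.indicator fun _ => 1) M)
    (hN : ∀ i, IsMulOperator ((D i).indicator fun _ => 1) (N i)) :
    T * M = ∑ i, N i * S i := by
  have hsum : T = ∑ i, S i := by
    subst hunion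
    exact hT.unique (IsGramOperator.sum hS hdisj)
  refine operator_ext_entries fun g h => ?_
  rw [hM.entry_mul_right, entry_sum, hsum,
    entry_sum, Finset.sum_mul]
  refine Finset.sum_congr rfl fun i _ => ?_
  rw [(hN i).entry_mul_left, hS i]
  split_ifs with hgh
  · have : g ∈ D i ↔ h ∈ C₂ := by
      rw [← hD i _ hgh, Set.mem_smul_set_iff_inv_smul_mem]
      simp
    rw [mul_comm]
    simp only [Set.indicator, this]
  · simp

/-- Between elements of $\Gamma$ the Gram matrix is the identity, so only $g=h$ survives, and there
the support condition reads $\sigma_1^{-1}\sigma_2\in\Gamma$. -/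
theorem IsCosetBasis.compress_mul (hw : IsCosetBasis Γ w) {σ₁ σ₂ : G}
    {S T M : EllTwo G →L[ℂ] EllTwo G} (hS : IsGramOperator w (σ₁ • (Γ : Set G)) S)
    (hT : IsGramOperator w (MulOpposite.op σ₂⁻¹ • (Γ : Set G)) T)
    (hM : IsMulOperator ((Γ : Set G).indicator fun _ => 1) M) :
    M * S * T * M = if σ₁⁻¹ * σ₂ ∈ Γ then M else 0 := by
  refine operator_ext_entries fun g h => ?_
  rw [hM.entry_mul_right, mul_assoc, hM.entry_mul_left, hw.isGramOperator_mul hS hT,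
    mem_biCos_iff, inv_inv]
  have hME : M (basisVec h) g = (Γ : Set G).indicator (fun _ => 1) g * basisVec h g := hM _ _
  by_cases hg : g ∈ Γ
  · by_cases hh : h ∈ Γ
    · rw [hw.inner_eq g h (Γ.mul_mem hg (Γ.inv_mem hh)), Set.indicator_of_mem hg,
        Set.indicator_of_mem hh]
      rcases eq_or_ne g h with rfl | hgh
      · simp only [mul_inv_cancel, mul_one, if_true, one_mul]
        split_ifs
        · rw [hME, basisVec_apply_self, Set.indicator_of_mem hg, one_mul]
        · rfl
      · simp only [if_neg hgh, ite_self, mul_zero, zero_mul]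
        split_ifs
        · rw [hME, basisVec_apply_ne hgh, mul_zero]
        · rfl
    · rw [Set.indicator_of_notMem (a := h) hh, mul_zero]
      split_ifs
      · rw [hME, basisVec_apply_ne (by rintro rfl; exact hh hg), mul_zero]
      · rfl
  · rw [Set.indicator_of_notMem (a := g) hg, zero_mul, zero_mul]
    split_ifs
    · rw [hME, Set.indicator_of_notMem hg, zero_mul]
    · rfl

variable {a : ι → G} {σ : G} {S T : ι → EllTwo G →L[ℂ] EllTwo G}

/-- $\chi_\Gamma$ restricts the summation index to $k\in\Gamma$, where
$gk^{-1}\in\Gamma\sigma\Gamma$ just says $g\in\Gamma\sigma\Gamma$. Parseval on the coset $\Gamma$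
then leaves $\delta_{g,h}$. -/
theorem IsCosetBasis.sum_mul_isMulOperator_mul (hw : IsCosetBasis Γ w)
    {M N : EllTwo G →L[ℂ] EllTwo G}
    (hdisj : Pairwise fun i j => Disjoint (MulOpposite.op (a i) • (Γ : Set G))
      (MulOpposite.op (a j) • (Γ : Set G)))
    (hunion : DoubleCoset.doubleCoset σ (Γ : Set G) (Γ : Set G) =
      ⋃ i, MulOpposite.op (a i) • (Γ : Set G))
    (hS : ∀ i, IsGramOperator w (MulOpposite.op (a i) • (Γ : Set G)) (S i))
    (hT : ∀ i, IsGramOperator w ((a i)⁻¹ • (Γ : Set G)) (T i))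
    (hM : IsMulOperator ((Γ : Set G).indicator fun _ => 1) M)
    (hN : IsMulOperator
      ((DoubleCoset.doubleCoset σ (Γ : Set G) (Γ : Set G)).indicator fun _ => 1) N) :
    ∑ i, S i * M * T i = N := by
  refine operator_ext_entries fun g h => ?_
  rw [entry_sum]
  have hsum := hasSum_sum (s := Finset.univ) fun i _ => hasSum_entry_comp (S i * M) (T i) g h
  refine hsum.unique ?_
  have key : ∀ k, ∑ i, (S i * M) (basisVec k) g * T i (basisVec h) k =
      if g * h⁻¹ ∈ Γ ∧ g ∈ DoubleCoset.doubleCoset σ (Γ : Set G) (Γ : Set G) then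
        (if k * (1 : G)⁻¹ ∈ Γ then inner ℂ (w g) (w k) * inner ℂ (w k) (w h) else 0)
      else (0 : ℂ) := fun k => by
    have h1 := sum_ite_rightCosets hdisj hunion (g * k⁻¹) (h * k⁻¹)
      (inner ℂ (w g) (w k)) (inner ℂ (w k) (w h))
    simp only [mul_inv_rev, inv_inv] at h1
    simp only [hM.entry_mul_right, hS _ g, hT _ _ h, mul_right_comm _ _ (ite _ _ _)]
    rw [← Finset.sum_mul, h1, show g * k⁻¹ * (k * h⁻¹) = g * h⁻¹ by group, inv_one, mul_one]
    by_cases hk : k ∈ Γ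
    · have : g * k⁻¹ ∈ DoubleCoset.doubleCoset σ (Γ : Set G) (Γ : Set G) ↔
          g ∈ DoubleCoset.doubleCoset σ (Γ : Set G) (Γ : Set G) := by
        simp only [DoubleCoset.mem_doubleCoset]
        constructor
        · rintro ⟨x, hx, y, hy, hxy⟩
          exact ⟨x, hx, y * k, Γ.mul_mem hy hk, by rw [← mul_assoc, ← hxy]; group⟩
        · rintro ⟨x, hx, y, hy, rfl⟩
          exact ⟨x, hx, y * k⁻¹, Γ.mul_mem hy (Γ.inv_mem hk), by group⟩
      rw [this, Set.indicator_of_mem hk, if_pos hk, mul_one]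
    · rw [Set.indicator_of_notMem hk, if_neg hk, mul_zero, ite_self]
  simp only [key]
  rw [hN]
  by_cases hg : g ∈ DoubleCoset.doubleCoset σ (Γ : Set G) (Γ : Set G)
  · simp only [hg, and_true, Set.indicator_of_mem hg, one_mul]
    split_ifs with hgh
    · convert hw.hasSum_inner 1 (w g) (w h) using 1
      rw [hw.inner_eq g h hgh]
      split_ifs with heq
      · rw [heq, basisVec_apply_self]
      · rw [basisVec_apply_ne heq]
    · rw [basisVec_apply_ne (by rintro rfl; exact hgh (by simp [Γ.one_mem]))]
      exact hasSum_zero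
  · simp only [hg, and_false, if_false, Set.indicator_of_notMem hg, zero_mul]
    exact hasSum_zero

/-- The index $[\Gamma:\Gamma_\sigma]$ counts left cosets in $\Gamma\sigma\Gamma$, not the given
right cosets. The summation index runs over $k$ with $gk^{-1}\in\Gamma\sigma\Gamma=\bigsqcup_j
r_j\sigma\Gamma$, that is over the disjoint right cosets $\Gamma\sigma^{-1}r_j^{-1}g$, and Parseval
gives $\delta_{g,h}$ once for each $j$. -/
theorem IsCosetBasis.sum_mul_eq_index (hw : IsCosetBasis Γ w) (hΓ : IsAlmostNormal Γ)
    (hdisj : Pairwise fun i j => Disjoint (MulOpposite.op (a i) • (Γ : Set G))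
      (MulOpposite.op (a j) • (Γ : Set G)))
    (hunion : DoubleCoset.doubleCoset σ (Γ : Set G) (Γ : Set G) =
      ⋃ i, MulOpposite.op (a i) • (Γ : Set G))
    (hS : ∀ i, IsGramOperator w (MulOpposite.op (a i) • (Γ : Set G)) (S i))
    (hT : ∀ i, IsGramOperator w ((a i)⁻¹ • (Γ : Set G)) (T i)) :
    ∑ i, S i * T i = algebraMap ℂ _ ((conjInter Γ σ).relIndex Γ : ℂ) := by
  obtain ⟨r, hrΓ, hr⟩ := hΓ.exists_leftCoset_decomposition σ
  refine operator_ext_entries fun g h => ?_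
  rw [entry_sum]
  have hsum := hasSum_sum (s := Finset.univ) fun i _ => hasSum_entry_comp (S i) (T i) g h
  refine hsum.unique ?_
  have key : ∀ k, ∑ i, S i (basisVec k) g * T i (basisVec h) k =
      if g * h⁻¹ ∈ Γ then ∑ j, (if k * (σ⁻¹ * (r j)⁻¹ * g)⁻¹ ∈ Γ then
        inner ℂ (w g) (w k) * inner ℂ (w k) (w h) else 0) else (0 : ℂ) := fun k => by
    have h1 := sum_ite_rightCosets hdisj hunion (g * k⁻¹) (h * k⁻¹)
      (inner ℂ (w g) (w k)) (inner ℂ (w k) (w h))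
    simp only [mul_inv_rev, inv_inv] at h1
    simp only [hS _ g, hT _ _ h]
    rw [h1, show g * k⁻¹ * (k * h⁻¹) = g * h⁻¹ by group, ite_and]
    refine if_congr Iff.rfl ?_ rfl
    have hiff : ∀ j, k * (σ⁻¹ * (r j)⁻¹ * g)⁻¹ ∈ Γ ↔ g * k⁻¹ ∈ (r j * σ) • (Γ : Set G) :=
        fun j => by
      rw [mem_smul_subgroup_iff, ← Γ.inv_mem_iff]
      refine iff_of_eq (congrArg (· ∈ Γ) ?_)
      group
    simp only [hiff]
    split_ifs with hgk
    · obtain ⟨j, hj, hju⟩ := hr _ hgk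
      rw [Finset.sum_eq_single j _ (fun hj' => absurd (Finset.mem_univ j) hj'), if_pos hj]
      exact fun i _ hij => if_neg fun hi => hij (hju i hi)
    · refine (Finset.sum_eq_zero fun j _ => if_neg fun hj => hgk ?_).symm
      obtain ⟨γ, hγ, hγ'⟩ := hj
      exact DoubleCoset.mem_doubleCoset.2 ⟨r j, hrΓ j, γ, hγ, hγ'.symm⟩
  simp only [key]
  rw [Algebra.algebraMap_eq_smul_one, _root_.smul_apply,
    one_apply_eq_self, lp.coeFn_smul, Pi.smul_apply, smul_eq_mul]
  split_ifs with hgh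
  · convert hasSum_sum (s := Finset.univ) fun j _ =>
      hw.hasSum_inner (σ⁻¹ * (r j)⁻¹ * g) (w g) (w h) using 1
    rw [Finset.sum_const, Finset.card_univ, Fintype.card_fin, nsmul_eq_mul, hw.inner_eq g h hgh]
    split_ifs with heq
    · rw [heq, basisVec_apply_self]
    · rw [basisVec_apply_ne heq]
  · rw [basisVec_apply_ne (by rintro rfl; exact hgh (by simp [Γ.one_mem])), mul_zero]
    exact hasSum_zero

end Relations

end GramRelations

/-! ### Membership in the twisted group von Neumann algebra, and coefficients. -/

section TwistedGroupVonNeumann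

variable {G : Type*} [Group G]

theorem twistedLeft_apply (ε : G → G → Circle) (k : G) (ξ : EllTwo G) (h : G) :
    twistedLeft ε k ξ h = (ε k (k⁻¹ * h) : ℂ) * ξ (k⁻¹ * h) := rfl

theorem twistedLeft_basisVec (ε : G → G → Circle) (k h : G) :
    twistedLeft ε k (basisVec h) = (ε k h : ℂ) • basisVec (k * h) := by
  ext x
  rw [twistedLeft_apply, lp.coeFn_smul, Pi.smul_apply, smul_eq_mul]
  rcases eq_or_ne x (k * h) with rfl | hx
  · rw [inv_mul_cancel_left, basisVec_apply_self, basisVec_apply_self]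
  · rw [basisVec_apply_ne hx, basisVec_apply_ne (by rintro rfl; simp at hx), mul_zero, mul_zero]

theorem coeffVN_eq (ε : G → G → Circle) (x : EllTwo G →L[ℂ] EllTwo G) (k : G) :
    coeffVN ε x k = star (ε k 1 : ℂ) * x (basisVec 1) k := by
  rw [coeffVN, twistedLeft_basisVec, inner_smul_left, inner_basisVec_left, mul_one]
  rfl

theorem star_circle_mul_self (z : Circle) : star (z : ℂ) * z = 1 := by
  rw [Complex.star_def, Complex.conj_mul', Circle.norm_coe]
  norm_num

/-- A bounded operator with the matrix of `∑_{θ ∈ A} t(θ) λ_ε(θ)` commutes with the commutant of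
the operators `λ_ε(θ)`. -/
theorem commute_of_commute_twistedLeft {ε : G → G → Circle} {s : G → ℂ}
    {x T : EllTwo G →L[ℂ] EllTwo G} (hx : ∀ k, twistedLeft ε k * x = x * twistedLeft ε k)
    (hT : ∀ g h, T (basisVec h) g = s (g * h⁻¹) * (ε (g * h⁻¹) h : ℂ)) : x * T = T * x := by
  refine operator_ext_entries fun g h => ?_
  -- Substituting $k=\theta h$ in $xT$ and $k=\theta^{-1}g$ in $Tx$ makes the two sums agree term by
  -- term, because $x$ commutes with $\lambda_\varepsilon(\theta)$. No convergence of $\sum_\theta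
  -- s(\theta)\lambda_\varepsilon(\theta)$ is needed.
  have h1 := (Equiv.mulRight h).hasSum_iff.2 (hasSum_entry_comp x T g h)
  have h2 := ((Equiv.inv G).trans (Equiv.mulRight g)).hasSum_iff.2 (hasSum_entry_comp T x g h)
  refine h1.unique (h2.congr_fun fun θ => ?_)
  have hθ : (twistedLeft ε θ * x) (basisVec h) g = (x * twistedLeft ε θ) (basisVec h) g := by
    rw [hx]
  rw [mul_apply_eq_comp, mul_apply_eq_comp, twistedLeft_basisVec, map_smul, lp.coeFn_smul,
    Pi.smul_apply, smul_eq_mul, twistedLeft_apply] at hθ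
  simp only [Function.comp_apply, Equiv.coe_mulRight, Equiv.coe_trans, Equiv.inv_apply, hT,
    mul_inv_rev, inv_inv, mul_inv_cancel_right, mul_inv_cancel_left]
  rw [mul_assoc, hθ]
  ring

theorem isSeriesVN_of_entries {ε : G → G → Circle} {t : G → ℂ} {A : Set G}
    {T : EllTwo G →L[ℂ] EllTwo G}
    (hT : ∀ g h, T (basisVec h) g = A.indicator t (g * h⁻¹) * (ε (g * h⁻¹) h : ℂ)) :
    IsSeriesVN ε t A T := by
  refine ⟨?_, fun k => ?_⟩
  · change T ∈ StarSubalgebra.centralizer ℂ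
      (StarSubalgebra.centralizer ℂ (Set.range (twistedLeft ε)) :
        Set (EllTwo G →L[ℂ] EllTwo G))
    have key : ∀ x ∈ StarSubalgebra.centralizer ℂ (Set.range (twistedLeft ε)), x * T = T * x :=
      fun x hx => commute_of_commute_twistedLeft
        (fun k => ((StarSubalgebra.mem_centralizer_iff ℂ).1 hx _ ⟨k, rfl⟩).1) hT
    exact (StarSubalgebra.mem_centralizer_iff ℂ).2 fun x hx =>
      ⟨key x hx, key _ (star_mem hx)⟩
  · rw [coeffVN_eq, hT, inv_one, mul_one, mul_left_comm, star_circle_mul_self, mul_one]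

/-- By disjointness of the supports, the coefficient at a point of `A i` where `t` is nonzero
isolates `c i` in any linear relation. -/
theorem linearIndependent_of_isSeriesVN {ε : G → G → Circle} {t : G → ℂ} {ι : Type*}
    {A : ι → Set G} {T : ι → EllTwo G →L[ℂ] EllTwo G} (hT : ∀ i, IsSeriesVN ε t (A i) (T i))
    (hA : Pairwise fun i j => Disjoint (A i) (A j)) (ht : ∀ i, ∃ k ∈ A i, t k ≠ 0) :
    LinearIndependent ℂ T := by
  rw [linearIndependent_iff']
  intro s c hc i hi
  obtain ⟨k, hk, htk⟩ := ht i
  have h : coeffVN ε (∑ j ∈ s, c j • T j) k = ∑ j ∈ s, c j * coeffVN ε (T j) k := by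
    simp only [coeffVN, _root_.sum_apply, _root_.smul_apply, inner_sum, inner_smul_right]
  rw [hc, Finset.sum_eq_single i _ (fun h => absurd hi h), (hT i).2, Set.indicator_of_mem hk] at h
  · have h0 : c i * t k = 0 := by rw [← h]; simp [coeffVN]
    exact (mul_eq_zero.1 h0).resolve_right htk
  · intro j _ hji
    rw [(hT j).2, Set.indicator_of_notMem fun hj => Set.disjoint_left.1 (hA hji) hj hk, mul_zero]

end TwistedGroupVonNeumann

/-! ### The orbit vectors of a projective representation form a coset basis. -/

section ProjectiveRepresentations

open scoped Classical

theorem inner_star_star {K : Type*} (a b : EllTwo K) :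
    inner ℂ (star a) (star b) = inner ℂ b a := by
  rw [lp.inner_eq_tsum, lp.inner_eq_tsum]
  refine tsum_congr fun i => ?_
  simp [mul_comm]

variable {G : Type*} [Group G] {Γ : Subgroup G} {ε : G → G → Circle}
  {π : G → unitary (EllTwo Γ →L[ℂ] EllTwo Γ)}

/-- The complex conjugate of the vector `π(g)* 1`. -/
noncomputable def orbitVec (π : G → unitary (EllTwo Γ →L[ℂ] EllTwo Γ)) (g : G) : EllTwo Γ :=
  star ((star (π g : EllTwo Γ →L[ℂ] EllTwo Γ)) (basisVec 1))

theorem unitary_inner_map_map {H : Type*} [NormedAddCommGroup H] [InnerProductSpace ℂ H]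
    [CompleteSpace H] (u : unitary (H →L[ℂ] H)) (a b : H) :
    inner ℂ ((u : H →L[ℂ] H) a) ((u : H →L[ℂ] H) b) = inner ℂ a b := by
  rw [← ContinuousLinearMap.adjoint_inner_right, ← ContinuousLinearMap.star_eq_adjoint,
    ← mul_apply_eq_comp, Unitary.coe_star_mul_self, one_apply_eq_self]

/-- The cocycle identity for $\pi(gh^{-1})\pi(h)$ expresses $\pi(g)\pi(h)^*$ through $\pi(gh^{-1})$.
The conjugation built into `orbitVec` swaps the arguments of the inner product, so that $t$ appears
rather than its conjugate. -/
theorem inner_orbitVec (hπ : IsProjectiveRep ε π) (g h : G) :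
    inner ℂ (orbitVec π g) (orbitVec π h) = matCoeff π (g * h⁻¹) * (ε (g * h⁻¹) h : ℂ) := by
  have hmul := hπ.2 (g * h⁻¹) h
  rw [inv_mul_cancel_right] at hmul
  have hmul' : (π (g * h⁻¹) : EllTwo Γ →L[ℂ] EllTwo Γ) =
      (ε (g * h⁻¹) h : ℂ) • ((π g : EllTwo Γ →L[ℂ] EllTwo Γ) *
        star (π h : EllTwo Γ →L[ℂ] EllTwo Γ)) := by
    rw [← smul_mul_assoc, ← hmul, mul_assoc,
      Unitary.mul_star_self_of_mem (π h).2, mul_one]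
  rw [orbitVec, orbitVec, inner_star_star, matCoeff, hmul', _root_.smul_apply, inner_smul_left,
    mul_apply_eq_comp, ContinuousLinearMap.star_eq_adjoint (π g : EllTwo Γ →L[ℂ] EllTwo Γ),
    ContinuousLinearMap.adjoint_inner_right, mul_right_comm, starRingEnd_apply,
    star_circle_mul_self, one_mul]

theorem matCoeff_eq_zero (hext : ExtendsLeftRegular Γ ε π) {γ : G} (hγ : γ ∈ Γ) (h1 : γ ≠ 1) :
    matCoeff π γ = 0 := by
  have := hext ⟨γ, hγ⟩
  rw [matCoeff, this, twistedLeft_basisVec, inner_smul_left, inner_basisVec_left,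
    basisVec_apply_ne, mul_zero]
  simpa [Subtype.ext_iff] using h1

theorem inner_adjoint_basisVec (hπ : IsProjectiveRep ε π) (hext : ExtendsLeftRegular Γ ε π)
    (γ : Γ) (x : G) (b : EllTwo Γ) :
    inner ℂ ((star (π (γ * x) : EllTwo Γ →L[ℂ] EllTwo Γ)) (basisVec 1)) b =
      star (ε γ x : ℂ) * (ε γ (γ⁻¹ : Γ) : ℂ) *
        ((π x : EllTwo Γ →L[ℂ] EllTwo Γ) b) γ⁻¹ := by
  have hmul : (π (γ * x) : EllTwo Γ →L[ℂ] EllTwo Γ) = star (ε γ x : ℂ) •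
      ((π γ : EllTwo Γ →L[ℂ] EllTwo Γ) * (π x : EllTwo Γ →L[ℂ] EllTwo Γ)) := by
    rw [hπ.2, smul_smul, star_circle_mul_self, one_smul]
  rw [ContinuousLinearMap.star_eq_adjoint, ContinuousLinearMap.adjoint_inner_left, hmul, hext,
    _root_.smul_apply, inner_smul_right, inner_basisVec_left, mul_apply_eq_comp,
    twistedLeft_apply, mul_one, mul_assoc]

/-- Parseval for $\pi(x)a$ and $\pi(x)b$ in the standard basis of $\ell^2(\Gamma)$, pulled back by
the unitary $\pi(x)$ and reindexed by $\gamma\mapsto\gamma^{-1}$. The cocycle phases have modulus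
one and cancel in each product. -/
theorem hasSum_inner_adjoint_basisVec (hπ : IsProjectiveRep ε π)
    (hext : ExtendsLeftRegular Γ ε π) (x : G) (a b : EllTwo Γ) :
    HasSum (fun k => if k * x⁻¹ ∈ Γ then
      inner ℂ a ((star (π k : EllTwo Γ →L[ℂ] EllTwo Γ)) (basisVec 1)) *
        inner ℂ ((star (π k : EllTwo Γ →L[ℂ] EllTwo Γ)) (basisVec 1)) b else 0)
      (inner ℂ a b) := by
  have hinj : Function.Injective fun γ : Γ => (γ : G) * x := fun γ δ h =>
    Subtype.ext (mul_right_cancel h)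
  refine (hinj.hasSum_iff fun k hk => if_neg fun hkx => hk ⟨⟨_, hkx⟩, by simp⟩).1 ?_
  have h := (Equiv.inv Γ).hasSum_iff.2 (lp.hasSum_inner (𝕜 := ℂ)
    ((π x : EllTwo Γ →L[ℂ] EllTwo Γ) a) ((π x : EllTwo Γ →L[ℂ] EllTwo Γ) b))
  rw [unitary_inner_map_map] at h
  refine h.congr_fun fun γ => ?_
  simp only [Function.comp_apply, mul_inv_cancel_right, SetLike.coe_mem, if_true,
    Equiv.inv_apply]
  rw [← inner_conj_symm, inner_adjoint_basisVec hπ hext, inner_adjoint_basisVec hπ hext]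
  have h1 := star_circle_mul_self (ε γ x)
  have h2 := star_circle_mul_self (ε γ (γ⁻¹ : Γ))
  simp only [RCLike.inner_apply, map_mul, starRingEnd_apply, star_star]
  linear_combination (((π x : EllTwo Γ →L[ℂ] EllTwo Γ) b) γ⁻¹ *
    star (((π x : EllTwo Γ →L[ℂ] EllTwo Γ) a) γ⁻¹)) * ((star (ε γ x : ℂ) * ε γ x) * h2 + h1)

theorem isCosetBasis_orbitVec (hπ : IsProjectiveRep ε π) (hext : ExtendsLeftRegular Γ ε π) :
    IsCosetBasis Γ (orbitVec π) where
  hasSum_inner x a b := by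
    have h := hasSum_inner_adjoint_basisVec hπ hext x (star b) (star a)
    rw [inner_star_star] at h
    refine h.congr_fun fun k => ?_
    have h1 := inner_star_star ((star (π k : EllTwo Γ →L[ℂ] EllTwo Γ)) (basisVec 1)) (star b)
    have h2 := inner_star_star (star a) ((star (π k : EllTwo Γ →L[ℂ] EllTwo Γ)) (basisVec 1))
    rw [star_star] at h1 h2
    rw [orbitVec, h1, h2, mul_comm]
  inner_eq g h hgh := by
    split_ifs with heq
    · rw [heq, orbitVec, inner_star_star]
      have := unitary_inner_map_map (star (π h)) (basisVec 1) (basisVec 1)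
      rw [Unitary.coe_star] at this
      rw [this, inner_basisVec_left, basisVec_apply_self]
    · rw [inner_orbitVec hπ, matCoeff_eq_zero hext hgh (by simpa [mul_inv_eq_one] using heq),
        zero_mul]

theorem IsGramOperator.isSeriesVN (hπ : IsProjectiveRep ε π) {A : Set G}
    {T : EllTwo G →L[ℂ] EllTwo G} (hT : IsGramOperator (orbitVec π) A T) :
    IsSeriesVN ε (matCoeff π) A T :=
  isSeriesVN_of_entries fun g h => by
    rw [hT, inner_orbitVec hπ]
    split_ifs with hA
    · rw [Set.indicator_of_mem hA]
    · rw [Set.indicator_of_notMem hA, zero_mul]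

/-- If $t$ vanished on $\sigma\Gamma$, the unit vector $w(\sigma)$ would be orthogonal to the
orthonormal basis $w(k)$, $k\in\Gamma$. -/
theorem exists_matCoeff_ne_zero_left (hπ : IsProjectiveRep ε π)
    (hext : ExtendsLeftRegular Γ ε π) (σ : G) :
    ∃ k ∈ σ • (Γ : Set G), matCoeff π k ≠ 0 := by
  by_contra! h
  have hw := isCosetBasis_orbitVec hπ hext
  have hs := hw.hasSum_inner 1 (orbitVec π σ) (orbitVec π σ)
  rw [hw.inner_eq σ σ (by simp [Γ.one_mem]), if_pos rfl] at hs
  refine one_ne_zero (hs.unique (hasSum_zero.congr_fun fun k => ?_))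
  split_ifs with hk
  · rw [inner_orbitVec hπ σ k, h, zero_mul, zero_mul]
    rw [mem_smul_subgroup_iff]
    simpa using hk
  · rfl

/-- The same argument with $w(1)$ and the basis indexed by $\Gamma\sigma$. -/
theorem exists_matCoeff_ne_zero_right (hπ : IsProjectiveRep ε π)
    (hext : ExtendsLeftRegular Γ ε π) (σ : G) :
    ∃ k ∈ MulOpposite.op σ • (Γ : Set G), matCoeff π k ≠ 0 := by
  by_contra! h
  have hw := isCosetBasis_orbitVec hπ hext
  have hs := hw.hasSum_inner σ (orbitVec π 1) (orbitVec π 1)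
  rw [hw.inner_eq 1 1 (by simp [Γ.one_mem]), if_pos rfl] at hs
  refine one_ne_zero (hs.unique (hasSum_zero.congr_fun fun k => ?_))
  split_ifs with hk
  · rw [inner_orbitVec hπ k 1, h, zero_mul, mul_zero]
    rw [mem_op_smul_subgroup_iff]
    simpa using hk
  · rfl

end ProjectiveRepresentations

/-! ### The representation of the localized free coset algebra, and double cosets. -/

section Representation

variable {G : Type*} [Group G] {Γ : Subgroup G}

theorem exists_bound_of_mem_cosetFunctions (f : cosetFunctions Γ) :
    ∃ B : ℝ, ∀ g, ‖(f : G → ℂ) g‖ ≤ B := by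
  refine StarAlgebra.adjoin_induction (p := fun f _ => ∃ B : ℝ, ∀ g, ‖f g‖ ≤ B)
    ?_ ?_ ?_ ?_ ?_ f.2
  · rintro _ ⟨C, -, rfl⟩
    refine ⟨1, fun g => (norm_indicator_le_norm_self _ _).trans ?_⟩
    simp
  · exact fun c => ⟨‖c‖, fun g => le_rfl⟩
  · rintro x y - - ⟨B, hB⟩ ⟨B', hB'⟩
    exact ⟨B + B', fun g => (norm_add_le _ _).trans (add_le_add (hB g) (hB' g))⟩
  · rintro x y - - ⟨B, hB⟩ ⟨B', hB'⟩
    exact ⟨B * B', fun g => (norm_mul_le _ _).trans (mul_le_mul (hB g) (hB' g) (norm_nonneg _)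
      ((norm_nonneg _).trans (hB g)))⟩
  · rintro x - ⟨B, hB⟩
    exact ⟨B, fun g => (norm_star (x g)).trans_le (hB g)⟩

/-- An assignment of multiplication operators to the functions and of Gram operators to the cosets
defines a `*`-representation of the localized free coset algebra. -/
theorem IsCosetBasis.exists_starAlgHom {E : Type*} [NormedAddCommGroup E] [InnerProductSpace ℂ E]
    [CompleteSpace E] {w : G → E} (hw : IsCosetBasis Γ w) (hΓ : IsAlmostNormal Γ) :
    ∃ ρ : LocCosetAlg Γ →⋆ₐ[ℂ] (EllTwo G →L[ℂ] EllTwo G),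
      (∀ C : ModularCoset Γ, IsGramOperator w (C : Set G) (ρ (cosetElt C))) ∧
      ∀ f : cosetFunctions Γ, IsMulOperator (f : G → ℂ) (ρ (fnElt f)) := by
  choose T hT using fun C : ModularCoset Γ => hw.exists_isGramOperator hΓ C.2
  choose M hM using fun f : cosetFunctions Γ =>
    exists_mulOperator (f : G → ℂ) (exists_bound_of_mem_cosetFunctions f)
  replace hM : ∀ f : cosetFunctions Γ, IsMulOperator (f : G → ℂ) (M f) := hM
  have hMchar : ∀ (f : cosetFunctions Γ) (D : Set G), IsChar f D →
      IsMulOperator (D.indicator fun _ => 1) (M f) := fun f D hf => hf ▸ hM f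
  let φ : FreeCosetAlg Γ →ₐ[ℂ] (EllTwo G →L[ℂ] EllTwo G) :=
    FreeAlgebra.lift ℂ fun x : CosetGen Γ =>
      match x with
      | .coset C => T C
      | .fn f => M f
  have hφT : ∀ C, φ (freeCoset C) = T C := fun C => FreeAlgebra.lift_ι_apply _ _
  have hφM : ∀ f, φ (freeFn f) = M f := fun f => FreeAlgebra.lift_ι_apply _ _
  have hstar : ∀ a, φ (freeAdj a) = star (φ a) := fun a => by
    induction a using FreeAlgebra.induction with
    | grade0 c =>
      rw [freeAdj_algebraMap, AlgHom.commutes, AlgHom.commutes, starRingEnd_apply,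
        algebraMap_star_comm]
    -- Operators are determined by their entries and the Gram matrix is Hermitian, so the operator
    -- chosen for $C^{-1}$ is forced to be the adjoint of the one chosen for $C$.
    | grade1 x =>
      rw [freeAdj_ι]
      cases x with
      | coset C =>
        exact (hφT _).trans (((hT _).unique (hT C).star).trans (congrArg star (hφT C).symm))
      | fn f =>
        exact (hφM _).trans (((hM _).unique (hM f).star).trans (congrArg star (hφM f).symm))
    | mul a b ha hb => rw [freeAdj_mul, map_mul, map_mul, ha, hb, star_mul]
    | add a b ha hb => rw [freeAdj_add, map_add, map_add, ha, hb, star_add]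
  have hrel : ∀ ⦃a b⦄, CosetRel Γ a b → φ a = φ b := fun a b h => by
    induction h with
    | fn_add f g =>
      rw [map_add, hφM, hφM, hφM]
      exact (hM _).unique fun ξ k => by
        rw [_root_.add_apply, lp.coeFn_add, Pi.add_apply, hM, hM]
        exact (add_mul _ _ _).symm
    | fn_mul f g =>
      rw [map_mul, hφM, hφM, hφM]
      exact (hM _).unique fun ξ k => by
        rw [mul_apply_eq_comp, hM, hM]
        exact (mul_assoc _ _ _).symm
    | fn_const c =>
      rw [hφM, AlgHom.commutes]
      exact (hM _).unique fun ξ k => rfl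
    | unit =>
      rw [hφT, map_one]
      refine (hT _).unique ?_
      have := hw.isGramOperator_one
      rwa [← one_smul G (Γ : Set G)] at this
    | partition C D hdisj hunion =>
      simp only [map_sum, hφT]
      exact (hT C).unique (hunion ▸ IsGramOperator.sum (fun i => hT (D i)) hdisj)
    | localize C₁ C₂ A D f d hdisj hunion hD hf hd =>
      simp only [map_sum, map_mul, hφT, hφM]
      exact IsGramOperator.mul_isMulOperator hdisj hunion hD (hT C₁) (fun i => hT (A i))
        (hMchar f _ hf) (fun i => hMchar (d i) _ (hd i))
    | concat σ₁ σ₂ C hdisj hdisj' hunion =>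
      simp only [map_sum, map_mul, hφT]
      have h1 := IsGramOperator.sum (fun i => hw.isGramOperator_mul
        (hT (leftCos Γ (σ₁ i))) (hT (rightCos Γ (σ₂ i)))) hdisj
      have h2 := IsGramOperator.sum (fun j => hT (C j)) hdisj'
      exact (hunion ▸ h1).unique h2
    | ortho σ₁ σ₂ f hf =>
      simp only [map_mul, hφT, hφM]
      rw [hw.compress_mul (hT (leftCos Γ σ₁)) (hT (rightCos Γ σ₂⁻¹)) (hMchar f _ hf)]
      have hiff : leftCos Γ σ₁ = leftCos Γ σ₂ ↔ σ₁⁻¹ * σ₂ ∈ Γ := by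
        rw [Subtype.ext_iff]
        exact leftCoset_eq_iff Γ
      by_cases h : σ₁⁻¹ * σ₂ ∈ Γ
      · rw [if_pos h, if_pos (hiff.2 h), hφM]
      · rw [if_neg h, if_neg (mt hiff.1 h), map_zero]
    | basis σ s f d hdisj hunion hf hd =>
      simp only [map_sum, map_mul, hφT, hφM]
      exact hw.sum_mul_isMulOperator_mul hdisj hunion (fun i => hT (rightCos Γ (σ * s i)))
        (fun i => hT (leftCos Γ (σ * s i)⁻¹)) (hMchar f _ hf) (hMchar d _ hd)
    | index σ s hdisj hunion =>
      simp only [map_sum, map_mul, hφT, AlgHom.commutes]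
      exact hw.sum_mul_eq_index hΓ hdisj hunion (fun i => hT (rightCos Γ (σ * s i)))
        (fun i => hT (leftCos Γ (σ * s i)⁻¹))
    -- Starred relations need no separate check, since `φ` intertwines `freeAdj` with the operator
    -- adjoint.
    | adj h ih => rw [hstar, hstar, ih]
  let ψ : LocCosetAlg Γ →ₐ[ℂ] (EllTwo G →L[ℂ] EllTwo G) := RingQuot.liftAlgHom ℂ ⟨φ, hrel⟩
  have hψ : ∀ a, ψ (LocCosetAlg.mk Γ a) = φ a := RingQuot.liftAlgHom_mkAlgHom_apply ℂ φ hrel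
  refine ⟨{ ψ with
    map_star' := fun b => ?_ }, fun C => ?_, fun f => ?_⟩
  · obtain ⟨a, rfl⟩ := LocCosetAlg.mk_surjective Γ b
    change ψ (star _) = star (ψ _)
    rw [LocCosetAlg.star_mk, hψ, hψ, hstar]
  · change IsGramOperator w (C : Set G) (ψ (LocCosetAlg.mk Γ (freeCoset C)))
    rw [hψ, hφT]
    exact hT C
  · change IsMulOperator (f : G → ℂ) (ψ (LocCosetAlg.mk Γ (freeFn f)))
    rw [hψ, hφM]
    exact hM f

theorem eq_of_mem_of_mem_smul {σ τ x : G} (hσ : x ∈ σ • (Γ : Set G))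
    (hτ : x ∈ τ • (Γ : Set G)) : σ • (Γ : Set G) = τ • (Γ : Set G) := by
  rw [mem_smul_subgroup_iff] at hσ hτ
  rw [leftCoset_eq_iff]
  simpa [mul_assoc] using Γ.mul_mem hσ (Γ.inv_mem hτ)

theorem eq_of_mem_of_mem_op_smul {σ τ x : G} (hσ : x ∈ MulOpposite.op σ • (Γ : Set G))
    (hτ : x ∈ MulOpposite.op τ • (Γ : Set G)) :
    MulOpposite.op σ • (Γ : Set G) = MulOpposite.op τ • (Γ : Set G) := by
  rw [mem_op_smul_subgroup_iff] at hσ hτ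
  rw [op_smul_eq_op_smul_iff]
  simpa [mul_assoc] using Γ.mul_mem (Γ.inv_mem hσ) hτ

theorem self_mem_leftCos (σ : G) : σ ∈ (leftCos Γ σ : Set G) := ⟨1, Γ.one_mem, mul_one σ⟩

theorem smul_subset_doubleCoset {σ τ : G}
    (hτ : τ ∈ DoubleCoset.doubleCoset σ (Γ : Set G) (Γ : Set G)) :
    τ • (Γ : Set G) ⊆ DoubleCoset.doubleCoset σ (Γ : Set G) (Γ : Set G) := by
  obtain ⟨a, ha, b, hb, rfl⟩ := DoubleCoset.mem_doubleCoset.1 hτ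
  rintro _ ⟨γ, hγ, rfl⟩
  exact DoubleCoset.mem_doubleCoset.2 ⟨a, ha, b * γ, Γ.mul_mem hb hγ, mul_assoc _ _ _⟩

theorem IsAlmostNormal.finite_leftCos_subset (hΓ : IsAlmostNormal Γ) (σ : G) :
    {C : ModularCoset Γ | C ∈ Set.range (leftCos Γ) ∧
      (C : Set G) ⊆ DoubleCoset.doubleCoset σ (Γ : Set G) (Γ : Set G)}.Finite := by
  obtain ⟨r, -, hr⟩ := hΓ.exists_leftCoset_decomposition σ
  refine (Set.finite_range fun i => leftCos Γ (r i * σ)).subset ?_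
  rintro _ ⟨⟨τ, rfl⟩, hτ⟩
  obtain ⟨i, hi, -⟩ := hr τ (hτ (self_mem_leftCos τ))
  exact ⟨i, Subtype.ext (eq_of_mem_of_mem_smul hi (self_mem_leftCos τ))⟩

/-- Almost normality makes the set of left cosets in the double coset finite; otherwise the `finsum`
defining `doubleCosetElt` could take its default value $0$. -/
theorem IsAlmostNormal.isGramOperator_doubleCosetElt {E : Type*} [NormedAddCommGroup E]
    [InnerProductSpace ℂ E] {w : G → E} (hΓ : IsAlmostNormal Γ)
    {ρ : LocCosetAlg Γ →⋆ₐ[ℂ] (EllTwo G →L[ℂ] EllTwo G)}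
    (hρ : ∀ C : ModularCoset Γ, IsGramOperator w (C : Set G) (ρ (cosetElt C))) (σ : G) :
    IsGramOperator w (DoubleCoset.doubleCoset σ (Γ : Set G) (Γ : Set G))
      (ρ (doubleCosetElt Γ (DoubleCoset.doubleCoset σ (Γ : Set G) (Γ : Set G)))) := by
  have hfin := hΓ.finite_leftCos_subset σ
  rw [doubleCosetElt, finsum_mem_eq_finite_toFinset_sum _ hfin, map_sum, ← Finset.sum_coe_sort]
  have h := IsGramOperator.sum (fun C : hfin.toFinset => hρ C) ?_
  · convert h using 1
    ext x
    simp only [Set.mem_iUnion, Subtype.exists, Set.Finite.mem_toFinset]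
    constructor
    · intro hx
      exact ⟨x • (Γ : Set G), (leftCos Γ x).2, ⟨⟨x, rfl⟩, smul_subset_doubleCoset hx⟩,
        self_mem_leftCos x⟩
    · rintro ⟨C, hC, ⟨-, hCD⟩, hx⟩
      exact hCD hx
  · rintro ⟨C, hC⟩ ⟨C', hC'⟩ hne
    obtain ⟨⟨τ, rfl⟩, -⟩ := hfin.mem_toFinset.1 hC
    obtain ⟨⟨τ', rfl⟩, -⟩ := hfin.mem_toFinset.1 hC'
    refine Set.disjoint_left.2 fun x hx hx' => hne ?_
    exact Subtype.ext (Subtype.ext (eq_of_mem_of_mem_smul hx hx'))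

end Representation

theorem mainTheorem1 {G : Type*} [Group G] (Γ : Subgroup G) (hΓ : IsAlmostNormal Γ)
    (ε : G → G → Circle) (π : G → unitary (EllTwo Γ →L[ℂ] EllTwo Γ))
    (hπ : IsProjectiveRep ε π) (hext : ExtendsLeftRegular Γ ε π) :
    ∃ ρ : LocCosetAlg Γ →⋆ₐ[ℂ] (EllTwo G →L[ℂ] EllTwo G),
      (∀ C : ModularCoset Γ, IsSeriesVN ε (matCoeff π) (C : Set G) (ρ (cosetElt C))) ∧
      (∀ (f : cosetFunctions Γ) (ξ : EllTwo G) (g : G),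
        ρ (fnElt f) ξ g = (f : G → ℂ) g * ξ g) ∧
      (∀ σ₁ σ₂ : G, IsSeriesVN ε (matCoeff π) (biCos Γ σ₁ σ₂)
        (ρ (cosetElt (leftCos Γ σ₁) * cosetElt (rightCos Γ σ₂)))) ∧
      LinearIndependent ℂ (fun C : Set.range (leftCos Γ) => ρ (cosetElt (C : ModularCoset Γ))) ∧
      LinearIndependent ℂ (fun C : Set.range (rightCos Γ) => ρ (cosetElt (C : ModularCoset Γ))) ∧
      LinearIndependent ℂ (fun D : DoubleCosets Γ => ρ (doubleCosetElt Γ (D : Set G))) := by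
  have hw := isCosetBasis_orbitVec hπ hext
  obtain ⟨ρ, hρ, hρf⟩ := hw.exists_starAlgHom hΓ
  refine ⟨ρ, fun C => (hρ C).isSeriesVN hπ, hρf, fun σ₁ σ₂ => ?_, ?_, ?_, ?_⟩
  · rw [map_mul]
    exact (hw.isGramOperator_mul (hρ (leftCos Γ σ₁)) (hρ (rightCos Γ σ₂))).isSeriesVN hπ
  · refine linearIndependent_of_isSeriesVN
      (A := fun C : Set.range (leftCos Γ) => ((C : ModularCoset Γ) : Set G))
      (fun C => (hρ C).isSeriesVN hπ) ?_ ?_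
    · rintro ⟨_, σ, rfl⟩ ⟨_, τ, rfl⟩ hne
      exact Set.disjoint_left.2 fun x hx hx' =>
        hne (Subtype.ext (Subtype.ext (eq_of_mem_of_mem_smul hx hx')))
    · rintro ⟨_, σ, rfl⟩
      exact exists_matCoeff_ne_zero_left hπ hext σ
  · refine linearIndependent_of_isSeriesVN
      (A := fun C : Set.range (rightCos Γ) => ((C : ModularCoset Γ) : Set G))
      (fun C => (hρ C).isSeriesVN hπ) ?_ ?_
    · rintro ⟨_, σ, rfl⟩ ⟨_, τ, rfl⟩ hne
      exact Set.disjoint_left.2 fun x hx hx' =>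
        hne (Subtype.ext (Subtype.ext (eq_of_mem_of_mem_op_smul hx hx')))
    · rintro ⟨_, σ, rfl⟩
      exact exists_matCoeff_ne_zero_right hπ hext σ
  · refine linearIndependent_of_isSeriesVN (A := fun D : DoubleCosets Γ => (D : Set G))
      (ε := ε) (t := matCoeff π) ?_ ?_ ?_
    · rintro ⟨_, σ, rfl⟩
      exact (hΓ.isGramOperator_doubleCosetElt hρ σ).isSeriesVN hπ
    · rintro ⟨_, σ, rfl⟩ ⟨_, τ, rfl⟩ hne
      by_contra h
      exact hne (Subtype.ext (DoubleCoset.eq_of_not_disjoint h))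
    · rintro ⟨_, σ, rfl⟩
      obtain ⟨k, hk, hkt⟩ := exists_matCoeff_ne_zero_left hπ hext σ
      exact ⟨k, smul_subset_doubleCoset (DoubleCoset.mem_doubleCoset_self _ _ σ) hk, hkt⟩
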